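/- Let $\sigma \ge 2$ be an integer and let $\mathcal{T}_\sigma$ be the rooted regular tree with forward degree $\sigma$ (every vertex has exactly $\sigma$ children), with root $o$. Let the edges of $\mathcal{T}_\sigma$ carry i.i.d. random weights that are uniformly distributed on $(0,1)$. Put $I_0 = \{o\}$ and, for $N \ge 0$, let $I_{N+1}$ be obtained from $I_N$ by adjoining the edge of smallest weight among all edges having exactly one endpoint in $I_N$, together with its other endpoint. The invasion percolation cluster is $C = \bigcup_{N \ge 0} I_N$. For $n \ge 0$ let $C[0,n]$ denote the number of vertices of $C$ whose graph distance from $o$ is at most $n$. Then $$\sup_{n \in \mathbb{N}} \mathbb{E}\left(\frac{n^2}{C[0,n]}\right) < \infty .$$ -/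

import Mathlib

open MeasureTheory ProbabilityTheory

namespace InvasionTree

/-- The vertices of the rooted regular tree with forward degree `σ`, as finite words over an
alphabet of `σ` letters. The root is the empty word `[]`; the `σ` children of a vertex `u` are the
words `i :: u`, `i : Fin σ`; the parent of `i :: u` is `u`. -/
abbrev Vertex (σ : ℕ) : Type := List (Fin σ)

/-- The height of a vertex: its graph distance from the root. -/
def height {σ : ℕ} (v : Vertex σ) : ℕ := v.length

/-- The edges of the tree: `(u, i)` stands for the edge joining `u` to its child `i :: u`.
Every edge of the tree is represented by exactly one such pair. -/
abbrev Edge (σ : ℕ) : Type := Vertex σ × Fin σ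

/-- The lower endpoint (closer to the root) of an edge. -/
def Edge.base {σ : ℕ} (e : Edge σ) : Vertex σ := e.1

/-- The upper endpoint (farther from the root) of an edge. -/
def Edge.top {σ : ℕ} (e : Edge σ) : Vertex σ := e.2 :: e.1

/-- The boundary of a vertex set `S`: the edges from a vertex in `S` to a child outside `S`.
The sets `S` to which this is applied below contain the root and are connected, that is, they are
closed under taking parents, so these are all the edges with exactly one endpoint in `S`, and
the subgraph spanned by `S` consists of the edges `e` with `e.top ∈ S`. -/
def boundary {σ : ℕ} (S : Set (Vertex σ)) : Set (Edge σ) :=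
  {e | e.base ∈ S ∧ e.top ∉ S}

/-- One step of invasion percolation with weights `w`: adjoin the boundary edge of smallest
weight (it is unique when the weights are pairwise distinct, which is almost surely the case for
independent uniform weights). -/
def invadeStep {σ : ℕ} (w : Edge σ → ℝ) (S : Set (Vertex σ)) : Set (Vertex σ) :=
  S ∪ {v | ∃ e ∈ boundary S, (∀ f ∈ boundary S, w e ≤ w f) ∧ v = e.top}

/-- The (vertex set of the) cluster invaded from the root after `N` steps. -/
def invaded {σ : ℕ} (w : Edge σ → ℝ) : ℕ → Set (Vertex σ)
  | 0 => {[]}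
  | N + 1 => invadeStep w (invaded w N)

/-- The (vertex set of the) invasion percolation cluster. -/
def cluster {σ : ℕ} (w : Edge σ → ℝ) : Set (Vertex σ) := ⋃ N : ℕ, invaded w N

/-- The number of vertices of the invasion percolation cluster at heights `0, …, n`. (There are
only finitely many vertices of height at most `n` in the tree.) -/
noncomputable def clusterVolume {σ : ℕ} (w : Edge σ → ℝ) (n : ℕ) : ℕ :=
  {v : Vertex σ | v ∈ cluster w ∧ height v ≤ n}.ncard

end InvasionTree

/-! Call threshold of a vertex the smallest level at which it percolates inside the subtree above
it. The threshold of a vertex is the minimum over its children of `cross`, the maximum of the edge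
weight and the child's threshold. Almost surely the minimizer is unique; following minimizers traces
the backbone, along which thresholds decrease. The invasion cluster contains the backbone and,
because all thresholds exceed 1/σ, also every edge of weight at most 1/σ that it touches
(`Regular.cluster_closed`). Hence the volume V up to height 3m dominates the critical clusters,
truncated at depth m, in the branches hanging off the backbone vertices of heights m to 2m-1.

Given the threshold x of a backbone vertex, its off-backbone branches are independent and
conditioned on `cross` exceeding x. This is `lintegral_peel`; by it the subtree above the m-th
backbone vertex has a density with respect to `treeMeasure` that depends on its threshold alone. As
long as x - 1/σ ≤ ρ, a conditioned critical cluster of depth of order 1/ρ has Laplace transform at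
most 1 - cρ at the parameter ρ² (`closedMean_branchLaplace_le`). With ρ = k/m and m backbone
vertices, E exp(-(k/m)² V) ≤ e^{-ck} + P(m X > k), where X is the excess over 1/σ of the threshold
of the m-th backbone vertex.

Up to constants, m²/V is at most 1 + ∑ k exp(-(k/m)² V) over k ≤ εm (`sq_div_le_sum_exp`), so its
mean is bounded by a constant plus a multiple of ∑ k e^{-ck} + m² E X². It remains to see that E X²
= O(m⁻²) (`lintegral_iterate_backward_excess_le`): one step along the backbone lowers the second
moment of the excess by at least a constant times its third moment, because the threshold has a
bounded density and the percolation probability grows at least linearly above 1/σ. -/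

namespace InvasionTree

open scoped ENNReal

variable {σ : ℕ}

/-! ### Product structure: the branches at the root are i.i.d. -/

/-- Weight configurations on the edges of the tree. -/
abbrev Weights (σ : ℕ) : Type := Edge σ → unitInterval

/-- The restriction of a weight configuration to the subtree above the vertex `v`. -/
def shift (v : Vertex σ) (w : Weights σ) : Weights σ := fun e => w (e.1 ++ v, e.2)

theorem shift_shift (u v : Vertex σ) (w : Weights σ) :
    shift u (shift v w) = shift (u ++ v) w := by
  funext e
  simp [shift]

theorem shift_nil (w : Weights σ) : shift [] w = w := by
  funext e
  simp [shift]

@[fun_prop]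
theorem measurable_shift (v : Vertex σ) : Measurable (shift v : Weights σ → _) := by
  unfold shift
  fun_prop

/-- The law of independent uniform edge weights. -/
noncomputable def treeMeasure (σ : ℕ) : Measure (Weights σ) :=
  Measure.infinitePi fun _ : Edge σ => (volume : Measure unitInterval)

instance : IsProbabilityMeasure (treeMeasure σ) := by
  unfold treeMeasure
  infer_instance

/-- The `i`-th branch at the root: the weight of the `i`-th root edge, and the weights above it. -/
def branch (w : Weights σ) (i : Fin σ) : unitInterval × Weights σ := (w ([], i), shift [i] w)

@[fun_prop]
theorem measurable_branch (i : Fin σ) : Measurable fun w : Weights σ => branch w i := by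
  unfold branch
  fun_prop

/-- The law of a branch. -/
noncomputable def branchMeasure (σ : ℕ) : Measure (unitInterval × Weights σ) :=
  (volume : Measure unitInterval).prod (treeMeasure σ)

instance : IsProbabilityMeasure (branchMeasure σ) := by
  unfold branchMeasure
  infer_instance

/-- The weight configuration with prescribed branches. -/
def graft (z : Fin σ → unitInterval × Weights σ) : Weights σ := fun e =>
  if h : e.1 = [] then (z e.2).1 else (z (e.1.getLast h)).2 (e.1.dropLast, e.2)

theorem branch_graft (z : Fin σ → unitInterval × Weights σ) : branch (graft z) = z := by
  funext i
  refine Prod.ext ?_ ?_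
  · simp [branch, graft]
  · funext e
    simp [branch, graft, shift]

theorem measurable_graft : Measurable (graft : (Fin σ → unitInterval × Weights σ) → _) := by
  refine measurable_pi_lambda _ fun e => ?_
  unfold graft
  split_ifs <;> fun_prop

/-- The index of the branch at the root that contains a given edge. -/
def branchIndex (e : Edge σ) : Fin σ := if h : e.1 = [] then e.2 else e.1.getLast h

/-- The embedding of the edges of the tree onto the edges above the `i`-th child of the root. -/
def liftEdge (i : Fin σ) : Edge σ ↪ Edge σ where
  toFun e := (e.1 ++ [i], e.2)
  inj' e f h := by
    simp only [Prod.mk.injEq, List.append_cancel_right_eq] at h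
    exact Prod.ext h.1 h.2

@[simp]
theorem liftEdge_apply (i : Fin σ) (e : Edge σ) : liftEdge i e = (e.1 ++ [i], e.2) := rfl

@[simp]
theorem branchIndex_nil (i : Fin σ) : branchIndex ([], i) = i := by simp [branchIndex]

@[simp]
theorem branchIndex_append (u : Vertex σ) (i j : Fin σ) : branchIndex (u ++ [i], j) = i := by
  simp [branchIndex]

theorem prod_eq_prod_branch {M : Type*} [CommMonoid M] (s : Finset (Edge σ)) (f : Edge σ → M) :
    ∏ e ∈ s, f e = ∏ i, ((if ([], i) ∈ s then f ([], i) else 1) *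
      ∏ e ∈ s.preimage (liftEdge i) (liftEdge i).injective.injOn, f (liftEdge i e)) := by
  rw [← Finset.prod_fiberwise s branchIndex f]
  refine Finset.prod_congr rfl fun i _ => ?_
  rw [← Finset.prod_filter_mul_prod_filter_not _ (fun e : Edge σ => e.1 = [])]
  congr 1
  · have : {e ∈ {e ∈ s | branchIndex e = i} | e.1 = []} =
        if ([], i) ∈ s then {(([], i) : Edge σ)} else ∅ := by
      ext ⟨u, j⟩
      rw [Finset.mem_filter, Finset.mem_filter]
      split_ifs with h <;> simp only [Finset.mem_singleton, Prod.mk.injEq, Finset.notMem_empty]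
      · constructor
        · rintro ⟨⟨_, h2⟩, rfl⟩
          exact ⟨rfl, by simpa using h2⟩
        · rintro ⟨rfl, rfl⟩
          exact ⟨⟨h, by simp⟩, rfl⟩
      · rw [iff_false]
        rintro ⟨⟨h1, h2⟩, rfl⟩
        rw [branchIndex_nil] at h2
        exact h (h2 ▸ h1)
    rw [this]
    split_ifs <;> simp
  · symm
    refine Finset.prod_bij (fun e _ => liftEdge i e) ?_ ?_ ?_ ?_
    · intro e he
      rw [Finset.mem_preimage] at he
      rw [Finset.mem_filter, Finset.mem_filter]
      exact ⟨⟨he, by simp⟩, by simp⟩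
    · intro a _ b _ h
      exact (liftEdge i).injective h
    · rintro ⟨u, j⟩ he
      rw [Finset.mem_filter, Finset.mem_filter] at he
      obtain ⟨⟨h1, h2⟩, h3⟩ := he
      simp only at h3
      obtain ⟨u, k, rfl⟩ := (List.eq_nil_or_concat u).resolve_left h3
      rw [List.concat_eq_append] at h1 h2 ⊢
      rw [branchIndex_append] at h2
      subst h2
      exact ⟨(u, j), by rw [Finset.mem_preimage]; exact h1, rfl⟩
    · intros; rfl

/-- A cylinder over finitely many edges pulls back to a product over the branches, each factor being
a constraint on the root edge times a cylinder above it. The values on cylinders determine the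
infinite product measure. -/
theorem map_graft :
    (Measure.pi fun _ : Fin σ => branchMeasure σ).map graft = treeMeasure σ := by
  refine Measure.eq_infinitePi _ fun s t ht => ?_
  rw [Measure.map_apply measurable_graft (.pi s.countable_toSet fun _ _ => ht _)]
  have : graft ⁻¹' (s : Set (Edge σ)).pi t = Set.univ.pi fun i : Fin σ =>
      (if ([], i) ∈ s then t ([], i) else Set.univ) ×ˢ
      ((s.preimage (liftEdge i) (liftEdge i).injective.injOn : Finset _) : Set (Edge σ)).pi
        fun e => t (liftEdge i e) := by
    ext z
    simp only [Set.mem_preimage, Set.mem_pi, Finset.mem_coe, Set.mem_univ, true_imp_iff,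
      Set.mem_prod, Finset.mem_preimage]
    constructor
    · intro h i
      refine ⟨?_, fun e he => ?_⟩
      · split_ifs with hi
        · simpa [graft] using h _ hi
        · trivial
      · simpa [graft] using h _ he
    · rintro h ⟨u, j⟩ he
      rcases List.eq_nil_or_concat u with rfl | ⟨u, i, rfl⟩
      · simpa [graft, he] using (h j).1
      · rw [List.concat_eq_append] at he ⊢
        simpa [graft] using (h i).2 (u, j) he
  rw [this, Measure.pi_pi, prod_eq_prod_branch]
  refine Finset.prod_congr rfl fun i _ => ?_
  rw [branchMeasure, Measure.prod_prod, treeMeasure, Measure.infinitePi_pi _ fun e _ => ht _]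
  congr 1
  split_ifs <;> simp

theorem measurePreserving_branch :
    MeasurePreserving (branch (σ := σ)) (treeMeasure σ)
      (Measure.pi fun _ : Fin σ => branchMeasure σ) where
  measurable := by fun_prop
  map_eq := by
    rw [← map_graft, Measure.map_map (by fun_prop) measurable_graft]
    have : (branch (σ := σ)) ∘ graft = id := funext branch_graft
    rw [this, Measure.map_id]

theorem measurePreserving_shift (v : Vertex σ) :
    MeasurePreserving (shift v) (treeMeasure σ) (treeMeasure σ) := by
  induction v with
  | nil =>
    have : (shift [] : Weights σ → _) = id := funext shift_nil
    rw [this]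
    exact .id _
  | cons i v ih =>
    have h1 : MeasurePreserving (shift [i]) (treeMeasure σ) (treeMeasure σ) := by
      exact ((measurePreserving_snd (μ := (volume : Measure unitInterval))
        (ν := treeMeasure σ)).comp (measurePreserving_eval (fun _ : Fin σ => branchMeasure σ) i)).comp
          measurePreserving_branch
    have := h1.comp ih
    convert this using 1
    funext w
    simp [shift_shift]

theorem lintegral_prod_pi {ι Z : Type*} [Fintype ι] [MeasurableSpace Z] (κ : Measure Z)
    [IsProbabilityMeasure κ] {f : Z → ℝ≥0∞} (hf : Measurable f) :
    ∫⁻ v : ι → Z, ∏ j, f (v j) ∂Measure.pi (fun _ => κ) = (∫⁻ x, f x ∂κ) ^ Fintype.card ι := by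
  have h : iIndepFun (fun (j : ι) (v : ι → Z) => f (v j)) (Measure.pi fun _ => κ) :=
    iIndepFun_pi (X := fun _ => f) fun _ => hf.aemeasurable
  have h2 := lintegral_prod_eq_prod_lintegral_of_indepFun Finset.univ _ h fun j => by fun_prop
  rw [h2, Finset.prod_congr rfl fun j _ =>
    (measurePreserving_eval (fun _ : ι => κ) j).lintegral_comp hf]
  simp

/-- Integration of a product in which one distinguished coordinate is coupled to each of
the others. -/
theorem lintegral_pi_distinguished {Z : Type*} [MeasurableSpace Z] (κ : Measure Z)
    [IsProbabilityMeasure κ] {F : Z → ℝ≥0∞} (hF : Measurable F) {H : Z → Z → ℝ≥0∞}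
    (hH : Measurable fun p : Z × Z => H p.1 p.2) (i : Fin σ) :
    ∫⁻ z : Fin σ → Z, F (z i) * ∏ j ∈ Finset.univ.erase i, H (z i) (z j)
        ∂Measure.pi (fun _ => κ) = ∫⁻ y, F y * (∫⁻ x, H y x ∂κ) ^ (σ - 1) ∂κ := by
  obtain _ | n := σ
  · exact i.elim0
  have hm : ∀ y, Measurable (H y) := fun y => hH.comp measurable_prodMk_left
  have key := (measurePreserving_piFinSuccAbove (fun _ : Fin (n + 1) => κ) i).lintegral_comp
    (f := fun p : Z × (Fin n → Z) => F p.1 * ∏ j, H p.1 (p.2 j)) (by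
      refine (hF.comp measurable_fst).mul (Finset.measurable_prod _ fun j _ => ?_)
      exact hH.comp (by fun_prop : Measurable fun p : Z × (Fin n → Z) => (p.1, p.2 j)))
  rw [lintegral_prod _ (by
      refine ((hF.comp measurable_fst).mul (Finset.measurable_prod _ fun j _ => ?_)).aemeasurable
      exact hH.comp (by fun_prop : Measurable fun p : Z × (Fin n → Z) => (p.1, p.2 j)))] at key
  have h1 : ∀ y, ∫⁻ v : Fin n → Z, F y * ∏ j, H y (v j) ∂Measure.pi (fun _ => κ) =
      F y * (∫⁻ x, H y x ∂κ) ^ n := by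
    intro y
    have hp : Measurable fun v : Fin n → Z => ∏ j, H y (v j) :=
      Finset.measurable_prod _ fun j _ => (hm y).comp (measurable_pi_apply j)
    rw [lintegral_const_mul _ hp, lintegral_prod_pi κ (hm y), Fintype.card_fin]
  simp only [h1] at key
  rw [Nat.add_sub_cancel, ← key]
  refine lintegral_congr fun z => ?_
  have : Finset.univ.erase i = Finset.univ.map i.succAboveEmb := by
    ext j
    simp [Fin.exists_succAbove_eq_iff]
  rw [this, Finset.prod_map]
  rfl

/-! ### Percolation thresholds -/

/-- The smallest level at which the percolation cluster of the root reaches height `k`. -/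
noncomputable def level : ℕ → Weights σ → unitInterval
  | 0, _ => 0
  | k + 1, w => Finset.univ.inf fun i => max (w ([], i)) (level k (shift [i] w))

/-- The smallest level at which the percolation cluster of the root is infinite. -/
noncomputable def threshold (w : Weights σ) : ℝ := ⨆ k, (level k w : ℝ)

/-- The smallest level at which the root is connected to infinity through a given branch. -/
noncomputable def cross (z : unitInterval × Weights σ) : ℝ := max z.1 (threshold z.2)

@[fun_prop]
theorem measurable_level (k : ℕ) : Measurable (level k : Weights σ → unitInterval) := by
  induction k with
  | zero => exact measurable_const
  | succ k ih =>
    have : (level (k + 1) : Weights σ → unitInterval) = Finset.univ.inf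
        fun i (w : Weights σ) => max (w ([], i)) (level k (shift [i] w)) := by
      funext w
      simp [level, Finset.inf_apply]
    rw [this]
    refine Finset.inf_induction (p := Measurable) measurable_const (fun f hf g hg => hf.inf hg) ?_
    intro i _
    exact Measurable.max (by fun_prop) (ih.comp (measurable_shift _))

theorem bddAbove_level (w : Weights σ) : BddAbove (Set.range fun k => (level k w : ℝ)) :=
  ⟨1, by rintro _ ⟨k, rfl⟩; exact (level k w).2.2⟩

@[fun_prop]
theorem measurable_threshold : Measurable (threshold : Weights σ → ℝ) :=
  Measurable.iSup fun k => measurable_subtype_coe.comp (measurable_level k)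

@[fun_prop]
theorem measurable_cross : Measurable (cross : unitInterval × Weights σ → ℝ) :=
  (measurable_subtype_coe.comp measurable_fst).max (measurable_threshold.comp measurable_snd)

theorem threshold_le_iff_level {w : Weights σ} {x : ℝ} :
    threshold w ≤ x ↔ ∀ k, (level k w : ℝ) ≤ x := by
  rw [threshold, ciSup_le_iff (bddAbove_level w)]

theorem threshold_nonneg (w : Weights σ) : 0 ≤ threshold w :=
  (level 0 w).2.1.trans (le_ciSup (bddAbove_level w) 0)

theorem threshold_le_one (w : Weights σ) : threshold w ≤ 1 :=
  threshold_le_iff_level.2 fun k => (level k w).2.2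

theorem cross_le_iff {z : unitInterval × Weights σ} {x : ℝ} :
    cross z ≤ x ↔ (z.1 : ℝ) ≤ x ∧ threshold z.2 ≤ x := max_le_iff

theorem cross_le_one (z : unitInterval × Weights σ) : cross z ≤ 1 :=
  cross_le_iff.2 ⟨z.1.2.2, threshold_le_one _⟩

section

variable [NeZero σ]

theorem level_succ_le_iff {w : Weights σ} {k : ℕ} {x : ℝ} :
    (level (k + 1) w : ℝ) ≤ x ↔ ∃ i, (w ([], i) : ℝ) ≤ x ∧ (level k (shift [i] w) : ℝ) ≤ x := by
  constructor
  · intro h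
    obtain ⟨i, -, hi⟩ := Finset.exists_mem_eq_inf (Finset.univ : Finset (Fin σ))
      Finset.univ_nonempty fun i => max (w ([], i)) (level k (shift [i] w))
    rw [level, hi] at h
    exact ⟨i, le_trans (Subtype.coe_le_coe.2 (le_max_left _ _)) h,
      le_trans (Subtype.coe_le_coe.2 (le_max_right _ _)) h⟩
  · rintro ⟨i, h1, h2⟩
    have : level (k + 1) w ≤ max (w ([], i)) (level k (shift [i] w)) :=
      Finset.inf_le (Finset.mem_univ i)
    refine (Subtype.coe_le_coe.2 this).trans ?_
    rcases max_choice (w ([], i)) (level k (shift [i] w)) with h | h <;> rw [h] <;> assumption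

theorem level_le_succ (k : ℕ) (w : Weights σ) : (level k w : ℝ) ≤ level (k + 1) w := by
  induction k generalizing w with
  | zero => exact (level 1 w).2.1
  | succ k ih =>
    obtain ⟨i, h1, h2⟩ := level_succ_le_iff.1 (le_refl (level (k + 1 + 1) w : ℝ))
    exact level_succ_le_iff.2 ⟨i, h1, (ih _).trans h2⟩

theorem level_mono (w : Weights σ) : Monotone fun k => (level k w : ℝ) :=
  monotone_nat_of_le_succ fun k => level_le_succ k w

/-- Compactness: there are finitely many children and `level` increases with the height, so "at
every height some child" can be exchanged for "some child at every height". -/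
theorem threshold_le_iff {w : Weights σ} {x : ℝ} :
    threshold w ≤ x ↔ ∃ i, cross (branch w i) ≤ x := by
  simp only [cross_le_iff, branch, threshold_le_iff_level]
  constructor
  · intro h
    by_contra! hc
    have : ∀ i : Fin σ, ∃ k, (w ([], i) : ℝ) ≤ x → x < level k (shift [i] w) := by
      intro i
      by_cases hi : (w ([], i) : ℝ) ≤ x
      · obtain ⟨k, hk⟩ := hc i hi
        exact ⟨k, fun _ => hk⟩
      · exact ⟨0, fun h => absurd h hi⟩
    choose k hk using this
    obtain ⟨i, h1, h2⟩ := level_succ_le_iff.1 (h (Finset.univ.sup k + 1))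
    exact absurd ((level_mono _ (Finset.le_sup (f := k) (Finset.mem_univ i))).trans h2)
      (not_le.2 (hk i h1))
  · rintro ⟨i, h1, h2⟩ k
    exact (level_le_succ k w).trans (level_succ_le_iff.2 ⟨i, h1, h2 k⟩)

theorem threshold_le_cross (w : Weights σ) (i : Fin σ) : threshold w ≤ cross (branch w i) :=
  threshold_le_iff.2 ⟨i, le_rfl⟩

theorem threshold_eq_cross {w : Weights σ} {i : Fin σ}
    (h : ∀ j, j ≠ i → cross (branch w i) < cross (branch w j)) :
    threshold w = cross (branch w i) := by
  refine le_antisymm (threshold_le_cross w i) ?_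
  obtain ⟨j, hj⟩ := threshold_le_iff.1 (le_refl (threshold w))
  by_cases hji : j = i
  · rwa [hji] at hj
  · exact (h j hji).le.trans hj

end

/-! ### Peeling off the root of the backbone -/

/-- The expectation of `g` over the branches that do not connect to infinity at level `x`. -/
noncomputable def closedMean (g : unitInterval × Weights σ → ℝ≥0∞) (x : ℝ) : ℝ≥0∞ :=
  ∫⁻ z, {z | x < cross z}.indicator g z ∂branchMeasure σ

/-- Evaluation of `Φ` on the branch at the root that minimizes `cross`, multiplied by the values of
`g` on the other branches. -/
noncomputable def peel (g : unitInterval × Weights σ → ℝ≥0∞) (Φ : Weights σ → ℝ≥0∞)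
    (w : Weights σ) : ℝ≥0∞ :=
  ∑ i, Φ (branch w i).2 * ∏ j ∈ Finset.univ.erase i,
    {z | cross (branch w i) < cross z}.indicator g (branch w j)

theorem measurable_indicator_cross {g : unitInterval × Weights σ → ℝ≥0∞} (hg : Measurable g) :
    Measurable fun p : (unitInterval × Weights σ) × (unitInterval × Weights σ) =>
      {z | cross p.1 < cross z}.indicator g p.2 := by
  have : (fun p : (unitInterval × Weights σ) × (unitInterval × Weights σ) =>
      {z | cross p.1 < cross z}.indicator g p.2) =
      {p : (unitInterval × Weights σ) × (unitInterval × Weights σ) |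
        cross p.1 < cross p.2}.indicator fun p => g p.2 := by
    funext p
    simp [Set.indicator]
  rw [this]
  exact (hg.comp measurable_snd).indicator (measurableSet_lt (by fun_prop) (by fun_prop))

theorem measurable_closedMean {g : unitInterval × Weights σ → ℝ≥0∞} (hg : Measurable g) :
    Measurable (closedMean g) := by
  have : Measurable fun p : ℝ × (unitInterval × Weights σ) =>
      {z | p.1 < cross z}.indicator g p.2 := by
    have : (fun p : ℝ × (unitInterval × Weights σ) => {z | p.1 < cross z}.indicator g p.2) =
        {p : ℝ × (unitInterval × Weights σ) | p.1 < cross p.2}.indicator fun p => g p.2 := by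
      funext p
      simp [Set.indicator]
    rw [this]
    exact (hg.comp measurable_snd).indicator (measurableSet_lt (by fun_prop) (by fun_prop))
  exact this.lintegral_prod_right

theorem measurable_peel {g : unitInterval × Weights σ → ℝ≥0∞} (hg : Measurable g)
    {Φ : Weights σ → ℝ≥0∞} (hΦ : Measurable Φ) : Measurable (peel g Φ) := by
  refine Finset.measurable_sum _ fun i _ => ?_
  refine (hΦ.comp (by fun_prop)).mul (Finset.measurable_prod _ fun j _ => ?_)
  exact (measurable_indicator_cross hg).comp
    (by fun_prop : Measurable fun w : Weights σ => (branch w i, branch w j))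

/-- A nonzero summand of `peel` has the strict minimizer of `cross` as its index, so the root
threshold can be replaced by the `cross` of that branch. The other σ - 1 i.i.d. branches then see
the distinguished one only through this value, and all σ indices contribute equally. -/
theorem lintegral_peel [NeZero σ] {h : ℝ → ℝ≥0∞} (hh : Measurable h)
    {g : unitInterval × Weights σ → ℝ≥0∞} (hg : Measurable g)
    {Φ : Weights σ → ℝ≥0∞} (hΦ : Measurable Φ) :
    ∫⁻ w, h (threshold w) * peel g Φ w ∂treeMeasure σ =
      σ * ∫⁻ z, h (cross z) * Φ z.2 * closedMean g (cross z) ^ (σ - 1) ∂branchMeasure σ := by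
  have h1 : ∀ w : Weights σ, h (threshold w) * peel g Φ w =
      ∑ i, h (cross (branch w i)) * Φ (branch w i).2 * ∏ j ∈ Finset.univ.erase i,
        {z | cross (branch w i) < cross z}.indicator g (branch w j) := by
    intro w
    rw [peel, Finset.mul_sum]
    refine Finset.sum_congr rfl fun i _ => ?_
    rw [← mul_assoc]
    by_cases hi : ∀ j, j ≠ i → cross (branch w i) < cross (branch w j)
    · rw [threshold_eq_cross hi]
    · push Not at hi
      obtain ⟨j, hj, hij⟩ := hi
      have : ∏ j ∈ Finset.univ.erase i,
          {z | cross (branch w i) < cross z}.indicator g (branch w j) = 0 :=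
        Finset.prod_eq_zero (Finset.mem_erase.2 ⟨hj, Finset.mem_univ j⟩)
          (Set.indicator_of_notMem (by simpa using hij) _)
      rw [this, mul_zero, mul_zero]
  have hm : Measurable fun z : unitInterval × Weights σ => h (cross z) * Φ z.2 :=
    (hh.comp measurable_cross).mul (hΦ.comp measurable_snd)
  simp only [h1]
  have hmi : ∀ i : Fin σ, Measurable fun v : Fin σ → unitInterval × Weights σ =>
      h (cross (v i)) * Φ (v i).2 * ∏ j ∈ Finset.univ.erase i,
        {z | cross (v i) < cross z}.indicator g (v j) := fun i =>
    (hm.comp (measurable_pi_apply i)).mul (Finset.measurable_prod _ fun j _ =>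
      (measurable_indicator_cross hg).comp
        (by fun_prop : Measurable fun v : Fin σ → unitInterval × Weights σ => (v i, v j)))
  have hmw : ∀ i : Fin σ, Measurable fun w : Weights σ =>
      h (cross (branch w i)) * Φ (branch w i).2 * ∏ j ∈ Finset.univ.erase i,
        {z | cross (branch w i) < cross z}.indicator g (branch w j) := fun i =>
    (hmi i).comp measurePreserving_branch.measurable
  rw [lintegral_finsetSum _ fun i _ => hmw i]
  have h2 : ∀ i : Fin σ, ∫⁻ w, h (cross (branch w i)) * Φ (branch w i).2 *
      ∏ j ∈ Finset.univ.erase i, {z | cross (branch w i) < cross z}.indicator g (branch w j)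
        ∂treeMeasure σ =
      ∫⁻ z, h (cross z) * Φ z.2 * closedMean g (cross z) ^ (σ - 1) ∂branchMeasure σ := by
    intro i
    rw [measurePreserving_branch.lintegral_comp (hmi i)]
    exact lintegral_pi_distinguished (branchMeasure σ) hm
      (H := fun y z => {z | cross y < cross z}.indicator g z) (measurable_indicator_cross hg) i
  simp [h2]

/-! ### The percolation probability and the law of the threshold -/

theorem measureReal_branch_mem {S : Set (Weights σ)} {x : ℝ} (hx : 0 ≤ x) (hx1 : x ≤ 1) :
    (branchMeasure σ).real {z | (z.1 : ℝ) ≤ x ∧ z.2 ∈ S} = x * (treeMeasure σ).real S := by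
  have h1 : {z : unitInterval × Weights σ | (z.1 : ℝ) ≤ x ∧ z.2 ∈ S} =
      Set.Iic (⟨x, hx, hx1⟩ : unitInterval) ×ˢ S := by
    ext z
    rfl
  rw [h1, branchMeasure, measureReal_prod_prod, measureReal_def, unitInterval.volume_Iic,
    ENNReal.toReal_ofReal hx]

theorem measureReal_forall_branch {T : Set (unitInterval × Weights σ)} (hT : MeasurableSet T) :
    (treeMeasure σ).real {w | ∀ i, branch w i ∈ T} = (branchMeasure σ).real T ^ σ := by
  have h1 : {w : Weights σ | ∀ i, branch w i ∈ T} = branch ⁻¹' (Set.univ.pi fun _ => T) := by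
    ext w
    simp
  rw [h1, measurePreserving_branch.measureReal_preimage
    (MeasurableSet.univ_pi fun _ => hT).nullMeasurableSet, measureReal_def, Measure.pi_pi]
  simp [measureReal_def]

theorem measureReal_exists_branch {S : Set (Weights σ)} (hS : MeasurableSet S) {x : ℝ}
    (hx : 0 ≤ x) (hx1 : x ≤ 1) :
    (treeMeasure σ).real {w | ∃ i, (w ([], i) : ℝ) ≤ x ∧ shift [i] w ∈ S} =
      1 - (1 - x * (treeMeasure σ).real S) ^ σ := by
  have hT : MeasurableSet {z : unitInterval × Weights σ | (z.1 : ℝ) ≤ x ∧ z.2 ∈ S} :=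
    (measurableSet_le (measurable_subtype_coe.comp measurable_fst) measurable_const).inter
      (measurable_snd hS)
  rw [← measureReal_branch_mem hx hx1, ← probReal_compl_eq_one_sub hT,
    ← measureReal_forall_branch hT.compl, ← probReal_compl_eq_one_sub]
  · congr 1
    ext w
    simp [branch]
  · have : {w : Weights σ | ∀ i, branch w i ∈
        {z : unitInterval × Weights σ | (z.1 : ℝ) ≤ x ∧ z.2 ∈ S}ᶜ} =
        ⋂ i, (fun w : Weights σ => branch w i) ⁻¹'
          {z : unitInterval × Weights σ | (z.1 : ℝ) ≤ x ∧ z.2 ∈ S}ᶜ := by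
      ext w
      simp
    rw [this]
    exact MeasurableSet.iInter fun i => measurable_branch i hT.compl

/-- The probability that the root percolates at level `x`. -/
noncomputable def percProb (σ : ℕ) (x : ℝ) : ℝ := (treeMeasure σ).real {w | threshold w ≤ x}

theorem percProb_nonneg (x : ℝ) : 0 ≤ percProb σ x := measureReal_nonneg

theorem percProb_le_one (x : ℝ) : percProb σ x ≤ 1 := measureReal_le_one

theorem percProb_mono {x y : ℝ} (h : x ≤ y) : percProb σ x ≤ percProb σ y :=
  measureReal_mono fun _ hw => le_trans hw h

theorem measurableSet_threshold_le (x : ℝ) :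
    MeasurableSet {w : Weights σ | threshold w ≤ x} :=
  measurableSet_le (by fun_prop) measurable_const

theorem measureReal_lt_threshold (x : ℝ) :
    (treeMeasure σ).real {w | x < threshold w} = 1 - percProb σ x := by
  rw [percProb, ← probReal_compl_eq_one_sub (measurableSet_threshold_le x)]
  congr 1
  ext w
  simp

theorem measureReal_cross_le {x : ℝ} (hx : 0 ≤ x) (hx1 : x ≤ 1) :
    (branchMeasure σ).real {z | cross z ≤ x} = x * percProb σ x := by
  rw [percProb, ← measureReal_branch_mem hx hx1]
  simp only [cross_le_iff, Set.mem_ofPred_eq]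

theorem geom_sum_mono {a b : ℝ} (ha : 0 ≤ a) (hab : a ≤ b) :
    ∑ k ∈ Finset.range σ, a ^ k ≤ ∑ k ∈ Finset.range σ, b ^ k :=
  Finset.sum_le_sum fun _ _ => pow_le_pow_left₀ ha hab _

theorem geom_sum_le_card {a : ℝ} (ha : 0 ≤ a) (ha1 : a ≤ 1) :
    ∑ k ∈ Finset.range σ, a ^ k ≤ σ := by
  refine (geom_sum_mono ha ha1).trans ?_
  simp

/-- The term k = 1, present because σ ≥ 2, already contributes b - a. -/
theorem sub_le_geom_sum_sub (hσ : 2 ≤ σ) {a b : ℝ} (ha : 0 ≤ a) (hab : a ≤ b) :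
    b - a ≤ ∑ k ∈ Finset.range σ, b ^ k - ∑ k ∈ Finset.range σ, a ^ k := by
  rw [← Finset.sum_sub_distrib]
  have := Finset.single_le_sum (f := fun k => b ^ k - a ^ k) (s := Finset.range σ)
    (fun k _ => sub_nonneg.2 (pow_le_pow_left₀ ha hab k)) (Finset.mem_range.2 hσ : 1 ∈ _)
  simpa using this

section

variable [NeZero σ]

theorem percProb_eq {x : ℝ} (hx : 0 ≤ x) (hx1 : x ≤ 1) :
    percProb σ x = 1 - (1 - x * percProb σ x) ^ σ := by
  conv_lhs => rw [percProb]
  rw [percProb, ← measureReal_exists_branch (measurableSet_threshold_le x) hx hx1]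
  congr 1
  ext w
  exact threshold_le_iff.trans (exists_congr fun i => cross_le_iff)

/-- The recursion t ↦ 1 - (1 - xt)^σ preserves this lower bound, since (1 - y)^σ ≤ (1 + y)^{-σ} ≤
1/(1 + σy) by Bernoulli. Uniformity in k lets the bound pass to the infinite cluster. -/
theorem le_measureReal_level {x : ℝ} (hx : 0 < x) (hx1 : x ≤ 1) (k : ℕ) :
    1 - 1 / (σ * x) ≤ (treeMeasure σ).real {w | (level k w : ℝ) ≤ x} := by
  have hσ : (0 : ℝ) < σ := Nat.cast_pos.2 (NeZero.pos σ)
  induction k with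
  | zero =>
    have : {w : Weights σ | (level 0 w : ℝ) ≤ x} = Set.univ := by
      ext w
      simp [level, hx.le]
    rw [this, probReal_univ]
    have : 0 < 1 / (σ * x) := by positivity
    linarith
  | succ k ih =>
    have hS : MeasurableSet {w : Weights σ | (level k w : ℝ) ≤ x} :=
      measurableSet_le (by fun_prop) measurable_const
    simp only [level_succ_le_iff]
    have := measureReal_exists_branch hS hx.le hx1
    simp only [Set.mem_ofPred_eq] at this
    rw [this]
    set t := (treeMeasure σ).real {w | (level k w : ℝ) ≤ x} with ht
    have ht0 : 0 ≤ t := measureReal_nonneg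
    have ht1 : t ≤ 1 := measureReal_le_one
    have ha0 : 0 ≤ x * t := mul_nonneg hx.le ht0
    have ha1 : x * t ≤ 1 := mul_le_one₀ hx1 ht0 ht1
    have hb : 1 + σ * (x * t) ≤ (1 + x * t) ^ σ := one_add_mul_le_pow (by linarith) σ
    have hc : (1 - x * t) ^ σ * (1 + x * t) ^ σ ≤ 1 := by
      rw [← mul_pow]
      exact pow_le_one₀ (by nlinarith) (by nlinarith)
    have hd : σ * x ≤ 1 + σ * (x * t) := by
      have : σ * x * (1 - 1 / (σ * x)) ≤ σ * x * t := mul_le_mul_of_nonneg_left ih (by positivity)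
      rw [mul_sub, mul_one_div_cancel (by positivity)] at this
      linarith
    have he : (1 - x * t) ^ σ ≤ 1 / (σ * x) := by
      rw [le_div_iff₀ (by positivity)]
      refine le_trans (mul_le_mul_of_nonneg_left (hd.trans hb) ?_) hc
      exact pow_nonneg (by linarith) σ
    linarith

theorem le_percProb {x : ℝ} (hx : 0 < x) (hx1 : x ≤ 1) : 1 - 1 / (σ * x) ≤ percProb σ x := by
  have h1 : {w : Weights σ | threshold w ≤ x} = ⋂ k, {w | (level k w : ℝ) ≤ x} := by
    ext w
    simp [threshold_le_iff_level]
  have hanti : Antitone fun k => {w : Weights σ | (level k w : ℝ) ≤ x} := fun k l hkl w hw =>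
    le_trans (level_mono w hkl) hw
  rw [percProb, measureReal_def, h1, hanti.measure_iInter
    (fun k => (measurableSet_le (by fun_prop) measurable_const).nullMeasurableSet)
    ⟨0, measure_ne_top _ _⟩]
  refine (ENNReal.ofReal_le_iff_le_toReal ?_).1 (le_iInf fun k => ?_)
  · exact ne_top_of_le_ne_top (measure_ne_top (treeMeasure σ) {w | (level 0 w : ℝ) ≤ x})
      (iInf_le _ 0)
  · exact (ENNReal.ofReal_le_iff_le_toReal (measure_ne_top _ _)).2 (le_measureReal_level hx hx1 k)

/-- This is the fixed point equation `percProb_eq` divided by x times the percolation probability.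
When that product vanishes the sum equals σ, and `le_percProb` rules out x > 1/σ. -/
theorem mul_geom_sum_le_one {x : ℝ} (hx : 0 ≤ x) (hx1 : x ≤ 1) :
    x * ∑ k ∈ Finset.range σ, (1 - x * percProb σ x) ^ k ≤ 1 ∧
      (0 < x * percProb σ x → x * ∑ k ∈ Finset.range σ, (1 - x * percProb σ x) ^ k = 1) := by
  have hσ : (0 : ℝ) < σ := Nat.cast_pos.2 (NeZero.pos σ)
  have h0 : 0 ≤ x * percProb σ x := mul_nonneg hx (percProb_nonneg x)
  have hpos : 0 < x * percProb σ x →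
      x * ∑ k ∈ Finset.range σ, (1 - x * percProb σ x) ^ k = 1 := by
    intro h
    have h1 := mul_neg_geom_sum (1 - x * percProb σ x) σ
    have h2 := percProb_eq (σ := σ) hx hx1
    have h3 : x * percProb σ x * (x * ∑ k ∈ Finset.range σ, (1 - x * percProb σ x) ^ k) =
        x * percProb σ x * 1 := by
      have : x * percProb σ x * (x * ∑ k ∈ Finset.range σ, (1 - x * percProb σ x) ^ k) =
        x * ((1 - (1 - x * percProb σ x)) *
          ∑ k ∈ Finset.range σ, (1 - x * percProb σ x) ^ k) := by ring
      rw [this, h1, ← h2, mul_one]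
    exact mul_left_cancel₀ h.ne' h3
  refine ⟨?_, hpos⟩
  rcases h0.eq_or_lt with h | h
  · rw [← h]
    simp only [sub_zero, one_pow, Finset.sum_const, Finset.card_range, nsmul_eq_mul, mul_one]
    rcases hx.eq_or_lt with rfl | hx0
    · simp
    · have h1 := le_percProb (σ := σ) hx0 hx1
      have h2 : percProb σ x = 0 := by
        rcases mul_eq_zero.1 h.symm with h | h
        · exact absurd h hx0.ne'
        · exact h
      rw [h2, sub_nonpos, one_le_div (by positivity)] at h1
      linarith
  · exact (hpos h).le

/-- A positive value would force the geometric sum to equal σ although its base is below 1. -/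
theorem percProb_inv (hσ : 2 ≤ σ) : percProb σ (1 / σ) = 0 := by
  have hσ0 : (0 : ℝ) < σ := Nat.cast_pos.2 (NeZero.pos σ)
  have hx : (0 : ℝ) < 1 / σ := by positivity
  have hx1 : (1 : ℝ) / σ ≤ 1 := by
    rw [div_le_one hσ0]
    exact_mod_cast NeZero.one_le
  by_contra hne
  have hpos : 0 < 1 / (σ : ℝ) * percProb σ (1 / σ) :=
    mul_pos hx (lt_of_le_of_ne (percProb_nonneg _) (Ne.symm hne))
  have hle : 1 / (σ : ℝ) * percProb σ (1 / σ) ≤ 1 :=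
    mul_le_one₀ hx1 (percProb_nonneg _) (percProb_le_one _)
  have h1 := (mul_geom_sum_le_one (σ := σ) hx.le hx1).2 hpos
  have h2 := sub_le_geom_sum_sub hσ (a := 1 - 1 / (σ : ℝ) * percProb σ (1 / σ)) (b := 1)
    (by linarith) (by linarith)
  rw [one_div, inv_mul_eq_one₀ hσ0.ne'] at h1
  simp only [one_div, one_pow, Finset.sum_const, Finset.card_range, nsmul_eq_mul, mul_one] at h2 hpos
  rw [one_div, ] at *
  linarith

/-- Let S_a and S_b be the geometric sums with bases za and zb. From b S_b = 1 and a S_a ≤ 1 one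
gets b (S_a - S_b) ≤ (b - a) S_a ≤ σ (b - a), while S_a - S_b ≥ za - zb and b ≥ 1/σ. This costs σ²;
passing from z to z^σ costs one more σ. -/
theorem percProb_sub_le_of_mem (hσ : 2 ≤ σ) {a b : ℝ} (ha : 0 ≤ a) (hab : a ≤ b) (hb : b ≤ 1) :
    percProb σ b - percProb σ a ≤ σ ^ 3 * (b - a) := by
  have hσ0 : (0 : ℝ) < σ := Nat.cast_pos.2 (NeZero.pos σ)
  have hb0 := ha.trans hab
  have ha1 := hab.trans hb
  set za := 1 - a * percProb σ a with hza
  set zb := 1 - b * percProb σ b with hzb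
  have hpa := percProb_nonneg (σ := σ) a
  have hpb := percProb_nonneg (σ := σ) b
  have hza1 : za ≤ 1 := by have := mul_nonneg ha hpa; linarith
  have hzb0 : 0 ≤ zb := by
    have := mul_le_one₀ hb hpb (percProb_le_one _); linarith
  have hzab : zb ≤ za := by
    have := mul_le_mul hab (percProb_mono (σ := σ) hab) hpa hb0
    linarith
  have hqa : percProb σ a = 1 - za ^ σ := percProb_eq ha ha1
  have hqb : percProb σ b = 1 - zb ^ σ := percProb_eq hb0 hb
  have hpow : za ^ σ - zb ^ σ ≤ σ * (za - zb) := by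
    have h := Commute.geom_sum₂_mul (Commute.all za zb) σ
    rw [← h]
    refine mul_le_mul_of_nonneg_right ?_ (by linarith)
    calc ∑ i ∈ Finset.range σ, za ^ i * zb ^ (σ - 1 - i) ≤ ∑ i ∈ Finset.range σ, 1 :=
          Finset.sum_le_sum fun i _ => mul_le_one₀ (pow_le_one₀ (hzb0.trans hzab) hza1)
            (pow_nonneg hzb0 _) (pow_le_one₀ hzb0 (hzab.trans hza1))
      _ = σ := by simp
  have hz : za - zb ≤ σ ^ 2 * (b - a) := by
    by_cases hzb1 : zb < 1
    · have h1 := (mul_geom_sum_le_one (σ := σ) hb0 hb).2 (by linarith)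
      have h2 := (mul_geom_sum_le_one (σ := σ) ha ha1).1
      rw [← hzb] at h1
      rw [← hza] at h2
      have h3 := sub_le_geom_sum_sub hσ hzb0 hzab
      have h4 := geom_sum_le_card (σ := σ) hzb0 hzb1.le
      have h5 := geom_sum_le_card (σ := σ) (hzb0.trans hzab) hza1
      set Sa := ∑ k ∈ Finset.range σ, za ^ k
      set Sb := ∑ k ∈ Finset.range σ, zb ^ k
      have h6 : b * (za - zb) ≤ σ * (b - a) := by
        have h7 : b * (za - zb) ≤ b * (Sa - Sb) := mul_le_mul_of_nonneg_left h3 hb0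
        have h8 : (b - a) * Sa ≤ (b - a) * σ := mul_le_mul_of_nonneg_left h5 (by linarith)
        nlinarith
      have h9 : 1 ≤ σ * b := by
        have := mul_le_mul_of_nonneg_left h4 hb0
        linarith
      have h10 : za - zb ≤ σ * b * (za - zb) := le_mul_of_one_le_left (by linarith) h9
      nlinarith
    · have : 0 ≤ (σ : ℝ) ^ 2 * (b - a) := mul_nonneg (by positivity) (by linarith)
      linarith
  rw [hqa, hqb]
  calc 1 - zb ^ σ - (1 - za ^ σ) = za ^ σ - zb ^ σ := by ring
    _ ≤ σ * (za - zb) := hpow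
    _ ≤ σ * (σ ^ 2 * (b - a)) := mul_le_mul_of_nonneg_left hz hσ0.le
    _ = σ ^ 3 * (b - a) := by ring

theorem percProb_sub_le (hσ : 2 ≤ σ) {a b : ℝ} (hab : a ≤ b) :
    percProb σ b - percProb σ a ≤ σ ^ 3 * (b - a) := by
  have hσ0 : (0 : ℝ) < σ := Nat.cast_pos.2 (NeZero.pos σ)
  have hs : 1 / (σ : ℝ) ≤ 1 := by
    rw [div_le_one hσ0]
    exact_mod_cast NeZero.one_le
  have h0 : (0 : ℝ) < 1 / σ := by positivity
  have hC : (0 : ℝ) ≤ σ ^ 3 := by positivity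
  rcases le_total b (1 / σ) with h | h
  · have := percProb_mono (σ := σ) h
    rw [percProb_inv hσ] at this
    have h2 := percProb_nonneg (σ := σ) a
    have := mul_nonneg hC (sub_nonneg.2 hab)
    linarith
  -- The percolation probability vanishes up to 1/σ and is constant from 1 on, so both endpoints may
  -- be clamped to [1/σ, 1], which does not increase their distance.
  · have key := percProb_sub_le_of_mem (σ := σ) hσ (a := min (max a (1 / σ)) 1) (b := min b 1)
      (le_min (h0.le.trans (le_max_right _ _)) zero_le_one)
      (min_le_min_right _ (max_le hab h)) (min_le_right _ _)
    have h1 : percProb σ b ≤ percProb σ (min b 1) := by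
      rcases le_total b 1 with hb | hb
      · rw [min_eq_left hb]
      · rw [min_eq_right hb]
        refine measureReal_mono fun w _ => threshold_le_one w
    have h2 : percProb σ (min (max a (1 / σ)) 1) ≤ percProb σ a := by
      refine (percProb_mono (min_le_left _ _)).trans ?_
      rcases le_total a (1 / σ) with ha | ha
      · rw [max_eq_right ha, percProb_inv hσ]
        exact percProb_nonneg _
      · rw [max_eq_left ha]
    have h3 : min b 1 - min (max a (1 / σ)) 1 ≤ b - a := by
      rcases le_total b 1 with hb | hb
      · rw [min_eq_left hb, min_eq_left (max_le (hab.trans hb) hs)]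
        linarith [le_max_left a (1 / σ)]
      · rw [min_eq_right hb]
        rcases le_total (max a (1 / (σ : ℝ))) 1 with hm | hm
        · rw [min_eq_left hm]
          linarith [le_max_left a (1 / σ)]
        · rw [min_eq_right hm]
          linarith
    have := mul_le_mul_of_nonneg_left h3 hC
    linarith

theorem sub_le_percProb {x : ℝ} (hx1 : x ≤ 1) : x - 1 / σ ≤ percProb σ x := by
  have hσ0 : (0 : ℝ) < σ := Nat.cast_pos.2 (NeZero.pos σ)
  rcases le_total x (1 / σ) with h | h
  · linarith [percProb_nonneg (σ := σ) x]
  · have h0 : 0 < x := lt_of_lt_of_le (by positivity) h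
    refine le_trans ?_ (le_percProb h0 hx1)
    have h1 : 1 - 1 / (σ * x) = (x - 1 / σ) / x := by field_simp
    rw [h1, le_div_iff₀ h0]
    nlinarith

/-- The law of the threshold has a bounded density. -/
theorem map_threshold_le (hσ : 2 ≤ σ) :
    (treeMeasure σ).map threshold ≤ ((σ : ℝ≥0∞) ^ 3) • (volume : Measure ℝ) := by
  set ν := (treeMeasure σ).map threshold with hν
  have : IsProbabilityMeasure ν := Measure.isProbabilityMeasure_map (by fun_prop)
  have hcdf : ∀ x, cdf ν x = percProb σ x := by
    intro x
    rw [cdf_eq_real, hν, map_measureReal_apply measurable_threshold measurableSet_Iic]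
    rfl
  -- The Lipschitz bound makes the complement of the distribution function monotone, and adding its
  -- Stieltjes measure turns the bound on increments into domination of measures.
  let G : StieltjesFunction ℝ :=
    { toFun := fun x => σ ^ 3 * x - cdf ν x
      mono' := by
        intro a b hab
        have := percProb_sub_le hσ hab
        simp only [hcdf]
        linarith
      right_continuous' := fun x =>
        ((continuous_const.mul continuous_id).continuousWithinAt).sub ((cdf ν).right_continuous x) }
  have hsum : cdf ν + G = (σ ^ 3 : NNReal) • StieltjesFunction.id := by
    ext x
    change cdf ν x + (σ ^ 3 * x - cdf ν x) = ((σ ^ 3 : NNReal) : ℝ) * x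
    push_cast
    ring
  have h := StieltjesFunction.measure_add (cdf ν) G
  rw [hsum, measure_cdf, StieltjesFunction.measure_smul] at h
  have h2 : (volume : Measure ℝ) = StieltjesFunction.id.measure := Real.volume_eq_stieltjes_id
  rw [h2]
  have h3 : ((σ : ℝ≥0∞) ^ 3) • StieltjesFunction.id.measure =
      (σ ^ 3 : NNReal) • StieltjesFunction.id.measure := by
    ext s
    simp [ENNReal.smul_def]
  rw [h3, h]
  exact Measure.le_add_right le_rfl

theorem ae_inv_lt_threshold (hσ : 2 ≤ σ) : ∀ᵐ w ∂treeMeasure σ, 1 / (σ : ℝ) < threshold w := by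
  have h := percProb_inv hσ
  rw [percProb, measureReal_eq_zero_iff] at h
  rw [ae_iff]
  simpa using h

theorem measure_threshold_eq (hσ : 2 ≤ σ) (x : ℝ) : treeMeasure σ {w | threshold w = x} = 0 := by
  have h := map_threshold_le hσ {x}
  rw [Measure.map_apply measurable_threshold (measurableSet_singleton x)] at h
  simpa [Set.preimage] using h

theorem measure_cross_eq (hσ : 2 ≤ σ) (x : ℝ) : branchMeasure σ {z | cross z = x} = 0 := by
  have h : {z : unitInterval × Weights σ | cross z = x} ⊆
      {u : unitInterval | (u : ℝ) = x} ×ˢ Set.univ ∪ Set.univ ×ˢ {w | threshold w = x} := by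
    intro z hz
    rcases max_choice (z.1 : ℝ) (threshold z.2) with h | h
    · exact Or.inl ⟨(h.symm.trans hz : (z.1 : ℝ) = x), trivial⟩
    · exact Or.inr ⟨trivial, (h.symm.trans hz : threshold z.2 = x)⟩
  refine measure_mono_null h (measure_union_null ?_ ?_)
  · rw [branchMeasure, Measure.prod_prod]
    have : {u : unitInterval | (u : ℝ) = x}.Subsingleton := fun a ha b hb =>
      Subtype.ext (ha.trans hb.symm)
    rw [this.measure_zero, zero_mul]
  · rw [branchMeasure, Measure.prod_prod, measure_threshold_eq hσ, mul_zero]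

end

/-! ### Transition of the threshold along the backbone -/

/-- At most one index is a strict minimizer of `cross`; when the minimum is tied every summand
vanishes. -/
theorem peel_one_le (w : Weights σ) : peel 1 1 w ≤ 1 := by
  by_cases h : ∃ i, ∀ j, j ≠ i → cross (branch w i) < cross (branch w j)
  · obtain ⟨i, hi⟩ := h
    rw [peel, Finset.sum_eq_single i]
    · rw [Pi.one_apply, one_mul]
      exact Finset.prod_le_one' fun j _ => Set.indicator_le_self' (fun _ _ => zero_le) _
    · intro k _ hk
      refine mul_eq_zero_of_right _ (Finset.prod_eq_zero
        (Finset.mem_erase.2 ⟨Ne.symm hk, Finset.mem_univ i⟩) ?_)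
      exact Set.indicator_of_notMem (by simpa using (hi k hk).le) _
    · simp
  · push Not at h
    rw [peel, Finset.sum_eq_zero]
    · exact zero_le
    · intro i _
      obtain ⟨j, hj, hij⟩ := h i
      refine mul_eq_zero_of_right _ (Finset.prod_eq_zero
        (Finset.mem_erase.2 ⟨hj, Finset.mem_univ j⟩) ?_)
      exact Set.indicator_of_notMem (by simpa using hij) _

/-- Integration over the weight of the edge below a subtree with threshold `t`, multiplied by the
number of children. -/
noncomputable def descend (σ : ℕ) (f : ℝ → ℝ≥0∞) (t : ℝ) : ℝ≥0∞ :=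
  σ * ∫⁻ u : unitInterval, f (max u t)

theorem measurable_descend {f : ℝ → ℝ≥0∞} (hf : Measurable f) : Measurable (descend σ f) := by
  refine Measurable.const_mul ?_ _
  have : Measurable fun p : ℝ × unitInterval => f (max p.2 p.1) :=
    hf.comp ((measurable_subtype_coe.comp measurable_snd).max measurable_fst)
  exact this.lintegral_prod_right

theorem lintegral_descend {f : ℝ → ℝ≥0∞} (hf : Measurable f) {Φ : Weights σ → ℝ≥0∞}
    (hΦ : Measurable Φ) :
    ∫⁻ w, descend σ f (threshold w) * Φ w ∂treeMeasure σ =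
      σ * ∫⁻ z, f (cross z) * Φ z.2 ∂branchMeasure σ := by
  have hm : Measurable fun z : unitInterval × Weights σ => f (cross z) * Φ z.2 :=
    (hf.comp measurable_cross).mul (hΦ.comp measurable_snd)
  rw [branchMeasure, lintegral_prod_symm' _ hm, ← lintegral_const_mul _ hm.lintegral_prod_left']
  refine lintegral_congr fun w => ?_
  have hu : Measurable fun u : unitInterval => f (max u (threshold w)) :=
    hf.comp (measurable_subtype_coe.max measurable_const)
  rw [descend, mul_assoc, ← lintegral_mul_const _ hu]
  rfl

/-- The backward transition operator of the threshold along the backbone. -/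
noncomputable def backward (σ : ℕ) (h : ℝ → ℝ≥0∞) : ℝ → ℝ≥0∞ :=
  descend σ fun x => h x * closedMean (1 : unitInterval × Weights σ → ℝ≥0∞) x ^ (σ - 1)

theorem measurable_mul_closedMean {h : ℝ → ℝ≥0∞} (hh : Measurable h) :
    Measurable fun x => h x * closedMean (1 : unitInterval × Weights σ → ℝ≥0∞) x ^ (σ - 1) :=
  hh.mul ((measurable_closedMean measurable_one).pow_const _)

theorem measurable_backward {h : ℝ → ℝ≥0∞} (hh : Measurable h) : Measurable (backward σ h) :=
  measurable_descend (measurable_mul_closedMean hh)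

theorem measurable_iterate_backward {h : ℝ → ℝ≥0∞} (hh : Measurable h) (n : ℕ) :
    Measurable ((backward σ)^[n] h) := by
  induction n generalizing h with
  | zero => exact hh
  | succ n ih => exact ih (measurable_backward hh)

theorem measurable_iterate_peel {g : unitInterval × Weights σ → ℝ≥0∞} (hg : Measurable g)
    {Φ : Weights σ → ℝ≥0∞} (hΦ : Measurable Φ) (n : ℕ) : Measurable ((peel g)^[n] Φ) := by
  induction n generalizing Φ with
  | zero => exact hΦ
  | succ n ih => exact ih (measurable_peel hg hΦ)

section

variable [NeZero σ]

theorem lintegral_peel_one {h : ℝ → ℝ≥0∞} (hh : Measurable h) {Φ : Weights σ → ℝ≥0∞}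
    (hΦ : Measurable Φ) :
    ∫⁻ w, h (threshold w) * peel 1 Φ w ∂treeMeasure σ =
      ∫⁻ w, backward σ h (threshold w) * Φ w ∂treeMeasure σ := by
  rw [lintegral_peel hh measurable_one hΦ, backward,
    lintegral_descend (measurable_mul_closedMean hh) hΦ]
  congr 1
  refine lintegral_congr fun z => ?_
  ring

/-- Each peeling moves from the test functional to the weight. With h = 1 it exhibits `(backward
σ)^[n] 1`, evaluated at the threshold, as the density of the subtree above the n-th backbone vertex.
-/
theorem lintegral_iterate_peel_one {h : ℝ → ℝ≥0∞} (hh : Measurable h) {Φ : Weights σ → ℝ≥0∞}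
    (hΦ : Measurable Φ) (n : ℕ) :
    ∫⁻ w, h (threshold w) * (peel 1)^[n] Φ w ∂treeMeasure σ =
      ∫⁻ w, (backward σ)^[n] h (threshold w) * Φ w ∂treeMeasure σ := by
  induction n generalizing h with
  | zero => rfl
  | succ n ih =>
    rw [Function.iterate_succ_apply', lintegral_peel_one hh
      (measurable_iterate_peel measurable_one hΦ n), ih (measurable_backward hh)]
    rfl

/-- The one-step marginal comparison: removing the root of the backbone. -/
theorem lintegral_cross_le {h : ℝ → ℝ≥0∞} (hh : Measurable h) :
    σ * ∫⁻ z, h (cross z) * closedMean (1 : unitInterval × Weights σ → ℝ≥0∞) (cross z) ^ (σ - 1)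
        ∂branchMeasure σ ≤ ∫⁻ w, h (threshold w) ∂treeMeasure σ := by
  have h1 := lintegral_peel (σ := σ) hh measurable_one measurable_one
  simp only [Pi.one_apply, mul_one] at h1
  rw [← h1]
  refine lintegral_mono fun w => ?_
  exact mul_le_of_le_one_right' (peel_one_le w)

theorem ae_inv_lt_cross (hσ : 2 ≤ σ) : ∀ᵐ z ∂branchMeasure σ, 1 / (σ : ℝ) < cross z := by
  have h : ∀ᵐ z ∂branchMeasure σ, 1 / (σ : ℝ) < threshold z.2 :=
    Measure.quasiMeasurePreserving_snd.ae (ae_inv_lt_threshold hσ)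
  filter_upwards [h] with z hz
  exact hz.trans_le (le_max_right _ _)

/-- Every peeled vertex yields a factor κ at its own threshold. Thresholds decrease along the
backbone and κ is increasing, so all n factors are bounded by the value at the root. -/
theorem lintegral_iterate_peel_le (hσ : 2 ≤ σ) {g : unitInterval × Weights σ → ℝ≥0∞}
    (hg : Measurable g) {κ : ℝ → ℝ≥0∞} (hκ : Monotone κ) (hκ1 : ∀ x, κ x ≤ 1)
    (hgκ : ∀ x, 1 / (σ : ℝ) < x → x ≤ 1 → closedMean g x ≤
      κ x * closedMean (1 : unitInterval × Weights σ → ℝ≥0∞) x) (n : ℕ)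
    {h : ℝ → ℝ≥0∞} (hh : Measurable h) :
    ∫⁻ w, h (threshold w) * (peel g)^[n] 1 w ∂treeMeasure σ ≤
      ∫⁻ w, h (threshold w) * κ (threshold w) ^ n ∂treeMeasure σ := by
  have hκm : Measurable κ := hκ.measurable
  induction n generalizing h with
  | zero => simp
  | succ n ih =>
    have hf := measurable_mul_closedMean (σ := σ) (hh.mul hκm)
    rw [Function.iterate_succ_apply', lintegral_peel hh hg
      (measurable_iterate_peel hg measurable_one n)]
    calc σ * ∫⁻ z, h (cross z) * (peel g)^[n] 1 z.2 * closedMean g (cross z) ^ (σ - 1)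
          ∂branchMeasure σ
        ≤ σ * ∫⁻ z, (h (cross z) * κ (cross z) *
            closedMean (1 : unitInterval × Weights σ → ℝ≥0∞) (cross z) ^ (σ - 1)) *
              (peel g)^[n] 1 z.2 ∂branchMeasure σ := by
          gcongr σ * ?_
          refine lintegral_mono_ae ?_
          filter_upwards [ae_inv_lt_cross hσ] with z hz
          have h1 : closedMean g (cross z) ^ (σ - 1) ≤ κ (cross z) *
              closedMean (1 : unitInterval × Weights σ → ℝ≥0∞) (cross z) ^ (σ - 1) := by
            refine (pow_le_pow_left' (hgκ _ hz (cross_le_one z)) _).trans ?_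
            rw [mul_pow]
            gcongr
            -- One of the σ - 1 ≥ 1 siblings suffices.
            exact pow_le_of_le_one zero_le (hκ1 _) (by omega)
          calc h (cross z) * (peel g)^[n] 1 z.2 * closedMean g (cross z) ^ (σ - 1)
              ≤ h (cross z) * (peel g)^[n] 1 z.2 * (κ (cross z) *
                closedMean (1 : unitInterval × Weights σ → ℝ≥0∞) (cross z) ^ (σ - 1)) := by
                gcongr
            _ = _ := by ring
      _ = ∫⁻ w, descend σ (fun x => h x * κ x *
            closedMean (1 : unitInterval × Weights σ → ℝ≥0∞) x ^ (σ - 1)) (threshold w) *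
              (peel g)^[n] 1 w ∂treeMeasure σ :=
          (lintegral_descend hf (measurable_iterate_peel hg measurable_one n)).symm
      _ ≤ ∫⁻ w, descend σ (fun x => h x * κ x *
            closedMean (1 : unitInterval × Weights σ → ℝ≥0∞) x ^ (σ - 1)) (threshold w) *
              κ (threshold w) ^ n ∂treeMeasure σ := ih (measurable_descend hf)
      _ = σ * ∫⁻ z, (h (cross z) * κ (cross z) *
            closedMean (1 : unitInterval × Weights σ → ℝ≥0∞) (cross z) ^ (σ - 1)) *
              κ (threshold z.2) ^ n ∂branchMeasure σ :=
          lintegral_descend hf ((hκm.comp measurable_threshold).pow_const n)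
      _ ≤ σ * ∫⁻ z, (h (cross z) * κ (cross z) ^ (n + 1)) *
            closedMean (1 : unitInterval × Weights σ → ℝ≥0∞) (cross z) ^ (σ - 1)
              ∂branchMeasure σ := by
          gcongr σ * ?_
          refine lintegral_mono fun z => ?_
          calc _ ≤ (h (cross z) * κ (cross z) *
            closedMean (1 : unitInterval × Weights σ → ℝ≥0∞) (cross z) ^ (σ - 1)) *
              κ (cross z) ^ n := by
                gcongr
                exact hκ (le_max_right _ _)
            _ = _ := by ring
      _ ≤ _ := lintegral_cross_le (hh.mul (hκm.pow_const _))

/-! ### Decay of the second moment of the excess along the backbone -/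

/-- The excess of a level over the critical value. -/
noncomputable def excess (σ : ℕ) (x : ℝ) : ℝ≥0∞ := ENNReal.ofReal (x - 1 / σ)

omit [NeZero σ] in
@[fun_prop]
theorem measurable_excess : Measurable (excess σ) := by
  unfold excess
  fun_prop

omit [NeZero σ] in
theorem excess_mono : Monotone (excess σ) := fun _ _ h => ENNReal.ofReal_le_ofReal (by linarith)

omit [NeZero σ] in
theorem excess_le_one {x : ℝ} (hx : x ≤ 1) : excess σ x ≤ 1 := by
  have : (0 : ℝ) ≤ 1 / σ := by positivity
  exact ENNReal.ofReal_le_one.2 (by linarith)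

omit [NeZero σ] in
theorem excess_ne_top (x : ℝ) : excess σ x ≠ ⊤ := ENNReal.ofReal_ne_top

-- If the edge weight is the larger of the two, its excess is u = t + e with t the excess of the
-- threshold above, and u² - t² = e (u + t) ≥ e u. Otherwise the truncated difference is zero. This
-- is the pointwise source of the dissipation.
omit [NeZero σ] in
theorem excess_sq_add_le (z : unitInterval × Weights σ) :
    excess σ (threshold z.2) ^ 2 +
      (excess σ z.1 - excess σ (threshold z.2)) * excess σ z.1 ≤ excess σ (cross z) ^ 2 := by
  rcases le_total (z.1 : ℝ) (threshold z.2) with h | h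
  · rw [tsub_eq_zero_of_le (excess_mono h), zero_mul, add_zero, cross, max_eq_right h]
  · rw [cross, max_eq_left h]
    obtain ⟨e, he⟩ := exists_add_of_le (excess_mono (σ := σ) h)
    rw [he, ENNReal.add_sub_cancel_left (excess_ne_top _)]
    calc _ ≤ excess σ (threshold z.2) ^ 2 + e * (excess σ (threshold z.2) + e) +
          excess σ (threshold z.2) * e := le_self_add
      _ = _ := by ring

/-- Restrict to thresholds below the midpoint of 1/σ and u. There the difference is at least half
the excess of u, and by `sub_le_percProb` this event has probability at least the same half; hence
the factor 4. -/
theorem sq_excess_le_lintegral (u : unitInterval) :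
    excess σ u ^ 2 ≤ 4 * ∫⁻ w, (excess σ u - excess σ (threshold w)) ∂treeMeasure σ := by
  set x : ℝ := u.1
  have hx1 : x ≤ 1 := u.2.2
  have hσ : (0 : ℝ) < σ := Nat.cast_pos.2 (NeZero.pos σ)
  have hs : 1 / (σ : ℝ) ≤ 1 := by
    rw [div_le_one hσ]
    exact_mod_cast NeZero.one_le
  set y := (x + 1 / σ) / 2 with hy
  rcases le_total x (1 / σ) with h | h
  · have : excess σ x = 0 := ENNReal.ofReal_of_nonpos (by linarith)
    rw [this]
    simp
  have hyx : ENNReal.ofReal (x - y) = excess σ x - excess σ y := by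
    rw [excess, excess, ← ENNReal.ofReal_sub _ (by linarith)]
    ring_nf
  have h1 : ENNReal.ofReal (x - y) * treeMeasure σ {w | threshold w ≤ y} ≤
      ∫⁻ w, (excess σ x - excess σ (threshold w)) ∂treeMeasure σ := by
    rw [← setLIntegral_const]
    calc ∫⁻ _ in {w : Weights σ | threshold w ≤ y}, ENNReal.ofReal (x - y) ∂treeMeasure σ
        ≤ ∫⁻ w in {w : Weights σ | threshold w ≤ y}, (excess σ x - excess σ (threshold w))
            ∂treeMeasure σ := by
          refine setLIntegral_mono' (measurableSet_threshold_le y) fun w hw => ?_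
          rw [hyx]
          exact tsub_le_tsub_left (excess_mono hw) _
      _ ≤ _ := setLIntegral_le_lintegral _ _
  have h2 : ENNReal.ofReal (y - 1 / σ) ≤ treeMeasure σ {w | threshold w ≤ y} := by
    refine ENNReal.ofReal_le_of_le_toReal ?_
    exact sub_le_percProb (σ := σ) (x := y) (by linarith)
  calc excess σ x ^ 2 = 4 * (ENNReal.ofReal (x - y) * ENNReal.ofReal (y - 1 / σ)) := by
        have h4 : (4 : ℝ≥0∞) = ENNReal.ofReal 4 := by simp
        rw [excess, h4, ← ENNReal.ofReal_mul (by linarith), ← ENNReal.ofReal_mul (by norm_num),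
          ← ENNReal.ofReal_pow (by linarith)]
        congr 1
        rw [hy]
        ring
    _ ≤ _ := by gcongr; exact (mul_le_mul_right h2 _).trans h1

theorem lintegral_threshold_le (hσ : 2 ≤ σ) {f : ℝ → ℝ≥0∞} (hf : Measurable f) :
    ∫⁻ w, f (threshold w) ∂treeMeasure σ ≤ (σ : ℝ≥0∞) ^ 3 * ∫⁻ u : unitInterval, f u := by
  have h1 : ∫⁻ w, f (threshold w) ∂treeMeasure σ =
      ∫⁻ w, (Set.Icc (0 : ℝ) 1).indicator f (threshold w) ∂treeMeasure σ := by
    refine lintegral_congr fun w => ?_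
    rw [Set.indicator_of_mem]
    exact ⟨threshold_nonneg w, threshold_le_one w⟩
  have hf' := hf.indicator (measurableSet_Icc (a := (0 : ℝ)) (b := 1))
  rw [h1, ← lintegral_map hf' measurable_threshold]
  refine (lintegral_mono' (map_threshold_le hσ) le_rfl).trans ?_
  rw [lintegral_smul_measure, lintegral_indicator measurableSet_Icc, smul_eq_mul]
  rw [← unitInterval.measurePreserving_coe.lintegral_comp hf]

/-- The value of `cross` is either the edge weight or the threshold above it, and the bounded
density reduces the second case to the first at cost σ³. For a uniform weight u, two of the three
powers of its excess are absorbed by `sq_excess_le_lintegral`. -/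
theorem lintegral_cube_excess_le (hσ : 2 ≤ σ) {f : ℝ → ℝ≥0∞} (hf : Measurable f) :
    ∫⁻ z, f (cross z) * excess σ (cross z) ^ 3 ∂branchMeasure σ ≤
      4 * (1 + (σ : ℝ≥0∞) ^ 3) * ∫⁻ z, f (cross z) *
        ((excess σ z.1 - excess σ (threshold z.2)) * excess σ z.1) ∂branchMeasure σ := by
  have hfe : Measurable fun x => f x * excess σ x ^ 3 := hf.mul (measurable_excess.pow_const 3)
  have hu : Measurable fun u : unitInterval => f u * excess σ u ^ 3 :=
    hfe.comp measurable_subtype_coe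
  have h1 : ∫⁻ z, f (cross z) * excess σ (cross z) ^ 3 ∂branchMeasure σ ≤
      (1 + (σ : ℝ≥0∞) ^ 3) * ∫⁻ u : unitInterval, f u * excess σ u ^ 3 := by
    calc _ ≤ ∫⁻ z : unitInterval × Weights σ, (f z.1 * excess σ z.1 ^ 3 +
            f (threshold z.2) * excess σ (threshold z.2) ^ 3) ∂branchMeasure σ := by
          refine lintegral_mono fun z => ?_
          rcases max_choice (z.1 : ℝ) (threshold z.2) with h | h <;> simp only [cross, h]
          · exact le_self_add
          · exact le_add_self
      _ = (∫⁻ u : unitInterval, f u * excess σ u ^ 3) +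
            ∫⁻ w, f (threshold w) * excess σ (threshold w) ^ 3 ∂treeMeasure σ := by
          have hu1 : Measurable fun z : unitInterval × Weights σ => f z.1 * excess σ z.1 ^ 3 :=
            hu.comp measurable_fst
          rw [lintegral_add_left hu1, branchMeasure]
          congr 1
          · exact measurePreserving_fst.lintegral_comp hu
          · exact measurePreserving_snd.lintegral_comp (hfe.comp measurable_threshold)
      _ ≤ _ := by
          rw [add_mul, one_mul]
          refine add_le_add_right ?_ _
          exact lintegral_threshold_le hσ hfe
  have h2 : ∫⁻ u : unitInterval, f u * excess σ u ^ 3 ≤ 4 * ∫⁻ z, f (cross z) *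
        ((excess σ z.1 - excess σ (threshold z.2)) * excess σ z.1) ∂branchMeasure σ := by
    have hc : ∀ z : unitInterval × Weights σ,
        f (cross z) * ((excess σ z.1 - excess σ (threshold z.2)) * excess σ z.1) =
        f z.1 * excess σ z.1 * (excess σ z.1 - excess σ (threshold z.2)) := by
      intro z
      rcases le_total (z.1 : ℝ) (threshold z.2) with h | h
      · rw [tsub_eq_zero_of_le (excess_mono h)]
        simp
      · rw [cross, max_eq_left h]
        ring
    have hm1 : Measurable fun u : unitInterval => f u * excess σ u :=
      (hf.comp measurable_subtype_coe).mul (measurable_excess.comp measurable_subtype_coe)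
    have hm2 : Measurable fun z : unitInterval × Weights σ =>
        excess σ z.1 - excess σ (threshold z.2) :=
      (measurable_excess.comp (measurable_subtype_coe.comp measurable_fst)).sub
        (measurable_excess.comp (measurable_threshold.comp measurable_snd))
    have hm3 : Measurable fun z : unitInterval × Weights σ =>
        f z.1 * excess σ z.1 * (excess σ z.1 - excess σ (threshold z.2)) :=
      (hm1.comp measurable_fst).mul hm2
    simp only [hc]
    rw [branchMeasure, lintegral_prod _ hm3.aemeasurable,
      ← lintegral_const_mul' _ _ (by simp)]
    refine lintegral_mono fun u => ?_
    have hm4 : Measurable fun w : Weights σ => excess σ u - excess σ (threshold w) :=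
      hm2.comp measurable_prodMk_left
    simp only
    rw [lintegral_const_mul _ hm4]
    calc f u * excess σ u ^ 3 = f u * excess σ u * excess σ u ^ 2 := by ring
      _ ≤ f u * excess σ u *
          (4 * ∫⁻ w, (excess σ u - excess σ (threshold w)) ∂treeMeasure σ) := by
            gcongr
            exact sq_excess_le_lintegral u
      _ = _ := by ring
  calc _ ≤ (1 + (σ : ℝ≥0∞) ^ 3) * (4 * _) := h1.trans (mul_le_mul_right h2 _)
    _ = _ := by ring

end

/-- Quadratic decay of a sequence of second moments under a dissipation by third moments. -/
theorem le_div_sq_of_dissipation {c : ℝ} (hc : 0 < c) (hc1 : c ≤ 1 / 2) {a b d : ℕ → ℝ}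
    (ha1 : ∀ n, a n ≤ 1) (hba : ∀ n, b n ≤ a n)
    (hab : ∀ n, a (n + 1) + c * d n ≤ b n)
    (hd : ∀ n, ∀ t : ℝ, 0 ≤ t → 3 / 2 * t * b n ≤ d n + t ^ 3 / 2) (n : ℕ) :
    a n ≤ 4 / c ^ 2 / (n + 1) ^ 2 := by
  have hB : 16 ≤ 4 / c ^ 2 := by
    rw [le_div_iff₀ (by positivity)]
    nlinarith
  set B := 4 / c ^ 2 with hBdef
  have hBc : B * c ^ 2 = 4 := by rw [hBdef]; field_simp
  -- The first indices follow from B ≥ 16 alone; afterwards N ≥ 3 keeps the coefficient 1 - 3/N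
  -- nonnegative.
  have hsmall : ∀ k : ℕ, k ≤ 2 → a k ≤ B / (k + 1) ^ 2 := by
    intro k hk
    refine (ha1 k).trans ?_
    rw [le_div_iff₀ (by positivity)]
    have : (k : ℝ) ≤ 2 := by exact_mod_cast hk
    have : (0 : ℝ) ≤ k := by positivity
    nlinarith
  induction n with
  | zero => exact hsmall 0 (by norm_num)
  | succ n ih =>
    rcases le_or_gt (n + 1) 2 with hn | hn
    · exact hsmall _ hn
    have hN : (3 : ℝ) ≤ (n : ℝ) + 1 := by exact_mod_cast hn
    push_cast
    set N : ℝ := (n : ℝ) + 1 with hNdef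
    have hN0 : 0 < N := by linarith
    -- This t makes the linear loss 3/N and the error B/N³, and the induction closes because (N -
    -- 2)(N + 1)² = N³ - 3N - 2.
    have h1 := hd n (2 / (c * N)) (by positivity)
    have h2 : c * (3 / 2 * (2 / (c * N)) * b n) ≤ c * (d n + (2 / (c * N)) ^ 3 / 2) :=
      mul_le_mul_of_nonneg_left h1 hc.le
    have h3 : c * (3 / 2 * (2 / (c * N)) * b n) = 3 / N * b n := by field_simp
    have h4 : c * ((2 / (c * N)) ^ 3 / 2) = B / N ^ 3 := by
      rw [hBdef]
      field_simp
      norm_num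
    have h5 : a (n + 1) ≤ (1 - 3 / N) * b n + B / N ^ 3 := by
      have := hab n
      rw [h3, mul_add, h4] at h2
      linarith
    have h6 : 0 ≤ 1 - 3 / N := by
      rw [sub_nonneg, div_le_one hN0]
      exact hN
    have h7 : (1 - 3 / N) * b n ≤ (1 - 3 / N) * (B / N ^ 2) :=
      mul_le_mul_of_nonneg_left ((hba n).trans ih) h6
    refine (h5.trans (add_le_add_left h7 _)).trans ?_
    have h8 : (1 - 3 / N) * (B / N ^ 2) + B / N ^ 3 = B * (N - 2) / N ^ 3 := by
      field_simp
      ring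
    rw [h8, div_le_div_iff₀ (by positivity) (by positivity), mul_assoc]
    refine mul_le_mul_of_nonneg_left ?_ (by linarith)
    nlinarith

section

variable [NeZero σ]

theorem lintegral_iterate_backward_le_one (n : ℕ) :
    ∫⁻ w, (backward σ)^[n] 1 (threshold w) ∂treeMeasure σ ≤ 1 := by
  induction n with
  | zero => simp
  | succ n ih =>
    rw [Function.iterate_succ_apply']
    have hm := measurable_iterate_backward (σ := σ) measurable_one n
    have h := lintegral_descend (σ := σ) (measurable_mul_closedMean (σ := σ) hm) measurable_one
    simp only [Pi.one_apply, mul_one] at h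
    rw [backward, h]
    exact (lintegral_cross_le hm).trans ih

/-- The difference of the two sides is (x - t)² (2x + t). Integrated with t free, this replaces
Hölder's inequality between second and third moments. -/
theorem tangent_cube_le (x t : ℝ≥0∞) (hx : x ≠ ⊤) (ht : t ≠ ⊤) :
    3 * t * x ^ 2 ≤ 2 * x ^ 3 + t ^ 3 := by
  lift x to NNReal using hx
  lift t to NNReal using ht
  norm_cast
  rw [← NNReal.coe_le_coe]
  push_cast
  nlinarith [x.2, t.2, mul_nonneg x.2 (sq_nonneg ((x : ℝ) - t)),
    mul_nonneg t.2 (sq_nonneg ((x : ℝ) - t)), show (0 : ℝ) ≤ x from x.2, show (0 : ℝ) ≤ t from t.2]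

/-- The second moment of the excess of the threshold of the `n`-th backbone vertex is of order
`n ^ (-2)`. -/
theorem lintegral_iterate_backward_excess_le (hσ : 2 ≤ σ) (n : ℕ) :
    ∫⁻ w, (backward σ)^[n] 1 (threshold w) * excess σ (threshold w) ^ 2 ∂treeMeasure σ ≤
      ENNReal.ofReal (64 * (1 + σ ^ 3) ^ 2 / (n + 1) ^ 2) := by
  set f : ℕ → ℝ → ℝ≥0∞ := fun n x => (backward σ)^[n] 1 x *
    closedMean (1 : unitInterval × Weights σ → ℝ≥0∞) x ^ (σ - 1) with hf
  set a : ℕ → ℝ≥0∞ := fun n =>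
    ∫⁻ w, (backward σ)^[n] 1 (threshold w) * excess σ (threshold w) ^ 2 ∂treeMeasure σ with ha
  -- A bound from below for the p-th moment at the n-th backbone vertex, written through the branch
  -- leading to the next one, so that consecutive thresholds appear in one integral.
  set A : ℕ → ℕ → ℝ≥0∞ := fun p n =>
    σ * ∫⁻ z, f n (cross z) * excess σ (cross z) ^ p ∂branchMeasure σ with hA
  have hhm : ∀ n, Measurable ((backward σ)^[n] 1) :=
    fun n => measurable_iterate_backward measurable_one n
  have hfm : ∀ n, Measurable (f n) := fun n => measurable_mul_closedMean (hhm n)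
  have hem : ∀ p, Measurable fun x => excess σ x ^ p := fun p => measurable_excess.pow_const p
  have hAle : ∀ p n, A p n ≤
      ∫⁻ w, (backward σ)^[n] 1 (threshold w) * excess σ (threshold w) ^ p ∂treeMeasure σ := by
    intro p n
    refine le_trans (le_of_eq ?_) (lintegral_cross_le ((hhm n).mul (hem p)))
    simp only [hA, hf, Pi.mul_apply]
    congr 1
    refine lintegral_congr fun z => ?_
    ring
  have hA1 : ∀ p n, A p n ≤ 1 := by
    intro p n
    refine (hAle p n).trans (le_trans (lintegral_mono fun w => ?_)
      (lintegral_iterate_backward_le_one n))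
    exact mul_le_of_le_one_right' (pow_le_one' (excess_le_one (threshold_le_one w)) _)
  have ha1 : ∀ n, a n ≤ 1 := by
    intro n
    refine (lintegral_mono fun w => ?_).trans (lintegral_iterate_backward_le_one n)
    exact mul_le_of_le_one_right' (pow_le_one' (excess_le_one (threshold_le_one w)) _)
  have hstep : ∀ n, 4 * (1 + (σ : ℝ≥0∞) ^ 3) * a (n + 1) + A 3 n ≤
      4 * (1 + (σ : ℝ≥0∞) ^ 3) * A 2 n := by
    intro n
    set K := 4 * (1 + (σ : ℝ≥0∞) ^ 3)
    have h1 : a (n + 1) =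
        σ * ∫⁻ z, f n (cross z) * excess σ (threshold z.2) ^ 2 ∂branchMeasure σ := by
      simp only [ha, Function.iterate_succ_apply']
      exact lintegral_descend (hfm n) ((hem 2).comp measurable_threshold)
    have hm1 : Measurable fun z : unitInterval × Weights σ =>
        f n (cross z) * excess σ (threshold z.2) ^ 2 :=
      ((hfm n).comp measurable_cross).mul ((hem 2).comp (measurable_threshold.comp measurable_snd))
    calc K * a (n + 1) + A 3 n
        ≤ K * (σ * ∫⁻ z, f n (cross z) * excess σ (threshold z.2) ^ 2 ∂branchMeasure σ) +
          σ * (K * ∫⁻ z, f n (cross z) *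
            ((excess σ z.1 - excess σ (threshold z.2)) * excess σ z.1) ∂branchMeasure σ) := by
          rw [h1]
          gcongr
          exact mul_le_mul_right (lintegral_cube_excess_le hσ (hfm n)) _
      _ = K * (σ * ∫⁻ z, (f n (cross z) * excess σ (threshold z.2) ^ 2 + f n (cross z) *
            ((excess σ z.1 - excess σ (threshold z.2)) * excess σ z.1)) ∂branchMeasure σ) := by
          rw [lintegral_add_left hm1]
          ring
      _ ≤ K * A 2 n := by
          refine mul_le_mul_right (mul_le_mul_right (lintegral_mono fun z => ?_) _) _
          rw [← mul_add]
          exact mul_le_mul_right (excess_sq_add_le z) _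
  have htan : ∀ n (t : ℝ≥0∞), t ≠ ⊤ → 3 * t * A 2 n ≤ 2 * A 3 n + t ^ 3 := by
    intro n t ht
    have hm3 : Measurable fun z : unitInterval × Weights σ =>
        f n (cross z) * (2 * excess σ (cross z) ^ 3) :=
      ((hfm n).comp measurable_cross).mul (((hem 3).comp measurable_cross).const_mul _)
    calc 3 * t * A 2 n
        = σ * ∫⁻ z, f n (cross z) * (3 * t * excess σ (cross z) ^ 2) ∂branchMeasure σ := by
          simp only [hA]
          rw [mul_left_comm, ← lintegral_const_mul' _ _ (by finiteness)]
          congr 1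
          refine lintegral_congr fun z => ?_
          ring
      _ ≤ σ * ∫⁻ z, (f n (cross z) * (2 * excess σ (cross z) ^ 3) + f n (cross z) * t ^ 3)
            ∂branchMeasure σ := by
          refine mul_le_mul_right (lintegral_mono fun z => ?_) _
          rw [← mul_add]
          exact mul_le_mul_right (tangent_cube_le _ _ (excess_ne_top _) ht) _
      _ = 2 * A 3 n + A 0 n * t ^ 3 := by
          rw [lintegral_add_left hm3, lintegral_mul_const' _ _ (by finiteness), mul_add]
          congr 1
          · simp only [hA]
            rw [mul_left_comm, ← lintegral_const_mul' 2 _ (by finiteness)]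
            congr 1
            refine lintegral_congr fun z => ?_
            ring
          · simp only [hA, pow_zero, mul_one]
            ring
      _ ≤ _ := by
          gcongr
          exact mul_le_of_le_one_left' (hA1 0 n)
  have hfin : ∀ {x : ℝ≥0∞}, x ≤ 1 → x ≠ ⊤ := fun h => ne_top_of_le_ne_top ENNReal.one_ne_top h
  have hK : (0 : ℝ) < 4 * (1 + σ ^ 3) := by positivity
  have hKr : (4 * (1 + (σ : ℝ≥0∞) ^ 3)).toReal = 4 * (1 + (σ : ℝ) ^ 3) := by
    rw [ENNReal.toReal_mul, ENNReal.toReal_add (by simp) (by finiteness)]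
    simp
  have hKt : 4 * (1 + (σ : ℝ≥0∞) ^ 3) ≠ ⊤ := by finiteness
  have hAa : ∀ n, A 2 n ≤ a n := hAle 2
  change a n ≤ _
  clear hAle
  clear_value a A
  generalize 4 * (1 + (σ : ℝ≥0∞) ^ 3) = K at hstep hKr hKt
  have key := le_div_sq_of_dissipation (c := 1 / (4 * (1 + σ ^ 3))) (by positivity)
    (a := fun n => (a n).toReal) (b := fun n => (A 2 n).toReal) (d := fun n => (A 3 n).toReal)
    (by
      rw [div_le_div_iff₀ (by positivity) (by positivity)]
      have : (0 : ℝ) ≤ (σ : ℝ) ^ 3 := by positivity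
      linarith)
    (fun n => by simpa using ENNReal.toReal_mono ENNReal.one_ne_top (ha1 n))
    (fun n => ENNReal.toReal_mono (hfin (ha1 n)) (hAa n))
    (fun n => by
      have h := ENNReal.toReal_mono (ENNReal.mul_ne_top hKt (hfin (hA1 2 n))) (hstep n)
      rw [ENNReal.toReal_add (ENNReal.mul_ne_top hKt (hfin (ha1 _)))
        (hfin (hA1 3 n)), ENNReal.toReal_mul, ENNReal.toReal_mul] at h
      rw [hKr] at h
      have h2 : (a (n + 1)).toReal + 1 / (4 * (1 + σ ^ 3)) * (A 3 n).toReal =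
          (4 * (1 + σ ^ 3) * (a (n + 1)).toReal + (A 3 n).toReal) / (4 * (1 + σ ^ 3)) := by
        field_simp
      rw [h2, div_le_iff₀ hK]
      linarith)
    (fun n t ht => by
      have h := ENNReal.toReal_mono
        (ENNReal.add_ne_top.2 ⟨ENNReal.mul_ne_top (by finiteness) (hfin (hA1 3 n)), by finiteness⟩)
        (htan n (ENNReal.ofReal t) ENNReal.ofReal_ne_top)
      rw [ENNReal.toReal_add (ENNReal.mul_ne_top (by finiteness) (hfin (hA1 3 n))) (by finiteness),
        ENNReal.toReal_mul, ENNReal.toReal_mul, ENNReal.toReal_mul, ENNReal.toReal_pow,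
        ENNReal.toReal_ofReal ht, ENNReal.toReal_ofNat, ENNReal.toReal_ofNat] at h
      linarith) n
  have hB : 4 / (1 / (4 * (1 + (σ : ℝ) ^ 3))) ^ 2 = 64 * (1 + σ ^ 3) ^ 2 := by
    field_simp
    ring
  rw [hB] at key
  exact (ENNReal.le_ofReal_iff_toReal_le (hfin (ha1 n)) (by positivity)).2 key

end

/-! ### Laplace functionals of critical clusters -/

/-- The number of vertices at height at most `r` in the critical percolation cluster of the
root. -/
noncomputable def criticalSize : ℕ → Weights σ → ℕ
  | 0, _ => 1
  | r + 1, w => 1 + ∑ i, if (w ([], i) : ℝ) ≤ 1 / σ then criticalSize r (shift [i] w) else 0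

theorem measurable_criticalSize (r : ℕ) : Measurable (criticalSize r : Weights σ → ℕ) := by
  induction r with
  | zero => exact measurable_const
  | succ r ih =>
    refine Measurable.const_add (Finset.measurable_sum _ fun i _ => ?_) _
    refine Measurable.ite (measurableSet_le ?_ measurable_const)
      (ih.comp (measurable_shift _)) measurable_const
    exact measurable_subtype_coe.comp (measurable_pi_apply _)

/-- The Laplace functional of the critical percolation cluster of the root. -/
noncomputable def criticalLaplace (s : ℝ) (r : ℕ) (w : Weights σ) : ℝ≥0∞ :=
  ENNReal.ofReal (Real.exp (-(s * criticalSize r w)))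

/-- The Laplace functional of the critical percolation cluster above a branch. -/
noncomputable def branchLaplace (s : ℝ) (r : ℕ) (z : unitInterval × Weights σ) : ℝ≥0∞ :=
  if (z.1 : ℝ) ≤ 1 / σ then criticalLaplace s r z.2 else 1

theorem branchLaplace_of_le {s : ℝ} {r : ℕ} {z : unitInterval × Weights σ}
    (h : (z.1 : ℝ) ≤ 1 / σ) : branchLaplace s r z = criticalLaplace s r z.2 := if_pos h

theorem branchLaplace_of_not_le {s : ℝ} {r : ℕ} {z : unitInterval × Weights σ}
    (h : ¬(z.1 : ℝ) ≤ 1 / σ) : branchLaplace s r z = 1 := if_neg h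

theorem measurable_criticalLaplace (s : ℝ) (r : ℕ) :
    Measurable (criticalLaplace s r : Weights σ → ℝ≥0∞) := by
  have : Measurable fun w : Weights σ => (criticalSize r w : ℝ) :=
    measurable_from_nat.comp (measurable_criticalSize r)
  unfold criticalLaplace
  fun_prop

theorem measurable_branchLaplace (s : ℝ) (r : ℕ) :
    Measurable (branchLaplace s r : unitInterval × Weights σ → ℝ≥0∞) :=
  Measurable.ite (measurableSet_le (measurable_subtype_coe.comp measurable_fst) measurable_const)
    ((measurable_criticalLaplace s r).comp measurable_snd) measurable_const

theorem criticalLaplace_le_one {s : ℝ} (hs : 0 ≤ s) (r : ℕ) (w : Weights σ) :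
    criticalLaplace s r w ≤ 1 := by
  refine ENNReal.ofReal_le_one.2 (Real.exp_le_one_iff.2 ?_)
  have : 0 ≤ s * criticalSize r w := by positivity
  linarith

theorem branchLaplace_le_one {s : ℝ} (hs : 0 ≤ s) (r : ℕ) (z : unitInterval × Weights σ) :
    branchLaplace s r z ≤ 1 := by
  unfold branchLaplace
  split_ifs
  · exact criticalLaplace_le_one hs r _
  · exact le_rfl

theorem criticalLaplace_succ (s : ℝ) (r : ℕ) (w : Weights σ) :
    criticalLaplace s (r + 1) w =
      ENNReal.ofReal (Real.exp (-s)) * ∏ i, branchLaplace s r (branch w i) := by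
  have h : ∀ i : Fin σ, branchLaplace s r (branch w i) = ENNReal.ofReal (Real.exp (-(s *
      ((if (w ([], i) : ℝ) ≤ 1 / σ then criticalSize r (shift [i] w) else 0 : ℕ) : ℝ)))) := by
    intro i
    by_cases hi : (w ([], i) : ℝ) ≤ 1 / σ
    · rw [if_pos hi, branchLaplace_of_le hi]
      rfl
    · rw [if_neg hi, branchLaplace_of_not_le hi]
      simp
  simp only [h]
  rw [← ENNReal.ofReal_prod_of_nonneg fun i _ => (Real.exp_pos _).le, ← Real.exp_sum,
    ← ENNReal.ofReal_mul (Real.exp_pos _).le, ← Real.exp_add, criticalLaplace, criticalSize]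
  congr 2
  push_cast
  rw [Finset.sum_neg_distrib, ← Finset.mul_sum]
  ring

section

variable [NeZero σ]

theorem lt_threshold_iff {w : Weights σ} {x : ℝ} :
    x < threshold w ↔ ∀ i, x < cross (branch w i) := by
  rw [← not_le, threshold_le_iff]
  push Not
  rfl

/-- The root does not percolate at level x exactly when no branch does, so the restricted functional
is a product over the i.i.d. branches. -/
theorem setLIntegral_criticalLaplace_succ (s : ℝ) (r : ℕ) (x : ℝ) :
    ∫⁻ w in {w | x < threshold w}, criticalLaplace s (r + 1) w ∂treeMeasure σ =
      ENNReal.ofReal (Real.exp (-s)) * closedMean (branchLaplace (σ := σ) s r) x ^ σ := by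
  have hS : MeasurableSet {w : Weights σ | x < threshold w} :=
    measurableSet_lt measurable_const measurable_threshold
  have hm : Measurable ({z | x < cross z}.indicator (branchLaplace (σ := σ) s r)) :=
    (measurable_branchLaplace s r).indicator (measurableSet_lt measurable_const measurable_cross)
  have h : ∀ w : Weights σ, {w | x < threshold w}.indicator (criticalLaplace s (r + 1)) w =
      ENNReal.ofReal (Real.exp (-s)) *
        ∏ i, {z | x < cross z}.indicator (branchLaplace (σ := σ) s r) (branch w i) := by
    intro w
    by_cases hw : x < threshold w
    · rw [Set.indicator_of_mem (by exact hw), criticalLaplace_succ]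
      congr 1
      refine Finset.prod_congr rfl fun i _ => ?_
      rw [Set.indicator_of_mem]
      exact lt_threshold_iff.1 hw i
    · rw [Set.indicator_of_notMem (by exact hw)]
      rw [lt_threshold_iff] at hw
      push Not at hw
      obtain ⟨i, hi⟩ := hw
      rw [Finset.prod_eq_zero (Finset.mem_univ i), mul_zero]
      exact Set.indicator_of_notMem (by simpa using hi) _
  rw [← lintegral_indicator hS]
  simp only [h]
  rw [lintegral_const_mul' _ _ ENNReal.ofReal_ne_top]
  congr 1
  have hprod : Measurable fun v : Fin σ → unitInterval × Weights σ =>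
      ∏ i, {z | x < cross z}.indicator (branchLaplace (σ := σ) s r) (v i) :=
    Finset.measurable_prod _ fun i _ => hm.comp (measurable_pi_apply i)
  rw [measurePreserving_branch.lintegral_comp hprod, lintegral_prod_pi _ hm, Fintype.card_fin]
  rfl

omit [NeZero σ] in
theorem lintegral_weight_le_mul {F : Weights σ → ℝ≥0∞} (hF : Measurable F) {x : ℝ} (hx : 0 ≤ x)
    (hx1 : x ≤ 1) :
    ∫⁻ z, {z : unitInterval × Weights σ | (z.1 : ℝ) ≤ x}.indicator (fun z => F z.2) z
      ∂branchMeasure σ = ENNReal.ofReal x * ∫⁻ w, F w ∂treeMeasure σ := by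
  have hS : MeasurableSet {u : unitInterval | (u : ℝ) ≤ x} :=
    measurableSet_le measurable_subtype_coe measurable_const
  have h : ∀ z : unitInterval × Weights σ,
      {z : unitInterval × Weights σ | (z.1 : ℝ) ≤ x}.indicator (fun z => F z.2) z =
        {u : unitInterval | (u : ℝ) ≤ x}.indicator 1 z.1 * F z.2 := by
    intro z
    by_cases hz : (z.1 : ℝ) ≤ x
    · rw [Set.indicator_of_mem (by exact hz), Set.indicator_of_mem (by exact hz)]
      simp
    · rw [Set.indicator_of_notMem (by exact hz), Set.indicator_of_notMem (by exact hz), zero_mul]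
  simp only [h]
  rw [branchMeasure, lintegral_prod_mul (measurable_one.indicator hS).aemeasurable hF.aemeasurable,
    lintegral_indicator_one hS]
  congr 1
  exact unitInterval.volume_Iic (x := ⟨x, hx, hx1⟩)

/-- A branch contributes 1 unless its edge has weight at most 1/σ ≤ x, and in that case `cross`
exceeds x if and only if the threshold above does. The identity is additive to avoid truncated
subtraction. -/
theorem closedMean_branchLaplace_add (s : ℝ) (r : ℕ) {x : ℝ} (hx : 1 / (σ : ℝ) ≤ x) :
    closedMean (branchLaplace (σ := σ) s r) x +
        ENNReal.ofReal (1 / σ) * treeMeasure σ {w | x < threshold w} =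
      closedMean (1 : unitInterval × Weights σ → ℝ≥0∞) x + ENNReal.ofReal (1 / σ) *
        ∫⁻ w in {w | x < threshold w}, criticalLaplace s r w ∂treeMeasure σ := by
  have hσ : (0 : ℝ) < σ := Nat.cast_pos.2 (NeZero.pos σ)
  have hs0 : (0 : ℝ) ≤ 1 / σ := by positivity
  have hs1 : 1 / (σ : ℝ) ≤ 1 := by
    rw [div_le_one hσ]
    exact_mod_cast NeZero.one_le
  have hS : MeasurableSet {w : Weights σ | x < threshold w} :=
    measurableSet_lt measurable_const measurable_threshold
  have hC : MeasurableSet {z : unitInterval × Weights σ | x < cross z} :=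
    measurableSet_lt measurable_const measurable_cross
  rw [← lintegral_indicator hS, ← lintegral_indicator_one hS,
    ← lintegral_weight_le_mul (measurable_one.indicator hS) hs0 hs1,
    ← lintegral_weight_le_mul ((measurable_criticalLaplace s r).indicator hS) hs0 hs1, closedMean,
    closedMean, ← lintegral_add_left ((measurable_branchLaplace s r).indicator hC),
    ← lintegral_add_left (measurable_one.indicator hC)]
  refine lintegral_congr fun z => ?_
  simp only [Set.indicator, Set.mem_ofPred_eq, branchLaplace, Pi.one_apply]
  by_cases h1 : (z.1 : ℝ) ≤ 1 / σ
  · have h2 : x < cross z ↔ x < threshold z.2 := by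
      rw [cross, lt_max_iff]
      exact or_iff_right (not_lt.2 (h1.trans hx))
    simp only [h1, h2, if_true]
    exact add_comm _ _
  · simp only [h1, if_false]

end

/-- With y = d/σ, Bernoulli and z ≤ 1 give (z + y)^σ ≥ z^σ (1 + d), and (z - y)^σ (z + y)^σ ≤
z^{2σ}; so (z - y)^σ ≤ z^σ/(1 + d). Combine with e^{-s} ≤ 1/(1 + s). -/
theorem criticality_step {z d s : ℝ} (hz0 : 0 < z) (hz1 : z ≤ 1) (hd0 : 0 ≤ d)
    (hdz : d ≤ z ^ σ) (hs : 0 ≤ s) (hσ : 1 ≤ σ) :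
    z ^ σ * ((s + d) / (1 + s + d)) ≤ z ^ σ - Real.exp (-s) * (z - d / σ) ^ σ := by
  have hσ0 : (0 : ℝ) < σ := by exact_mod_cast hσ
  have hσ1 : (1 : ℝ) ≤ σ := by exact_mod_cast hσ
  have hq : 0 < z ^ σ := by positivity
  have hzσ : z ^ σ ≤ z := pow_le_of_le_one hz0.le hz1 (by omega)
  have hy : d / σ ≤ z := (div_le_self hd0 hσ1).trans (hdz.trans hzσ)
  have hy0 : 0 ≤ d / σ := by positivity
  have h1 : z ^ σ * (1 + d) ≤ (z + d / σ) ^ σ := by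
    have hb : 1 + σ * (d / σ / z) ≤ (1 + d / σ / z) ^ σ :=
      one_add_mul_le_pow (by have : 0 ≤ d / σ / z := by positivity
                             linarith) σ
    have he : (z + d / σ) ^ σ = z ^ σ * (1 + d / σ / z) ^ σ := by
      rw [← mul_pow]
      congr 1
      field_simp
    rw [he]
    refine mul_le_mul_of_nonneg_left (le_trans ?_ hb) hq.le
    have : σ * (d / σ / z) = d / z := by field_simp
    rw [this]
    have := le_div_self hd0 hz0 hz1
    linarith
  have h2 : (z - d / σ) ^ σ * (z + d / σ) ^ σ ≤ z ^ σ * z ^ σ := by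
    rw [← mul_pow, ← mul_pow]
    exact pow_le_pow_left₀ (mul_nonneg (by linarith) (by linarith)) (by nlinarith) _
  have h3 : 0 ≤ (z - d / σ) ^ σ := pow_nonneg (by linarith) _
  have h4 : (z - d / σ) ^ σ * (1 + d) ≤ z ^ σ := by
    have : z ^ σ * ((z - d / σ) ^ σ * (1 + d)) ≤ z ^ σ * z ^ σ := by
      refine le_trans ?_ h2
      have := mul_le_mul_of_nonneg_left h1 h3
      linarith
    exact le_of_mul_le_mul_left this hq
  have h5 : Real.exp (-s) * (1 + s) ≤ 1 := by
    have := Real.add_one_le_exp s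
    calc Real.exp (-s) * (1 + s) ≤ Real.exp (-s) * Real.exp s := by
          refine mul_le_mul_of_nonneg_left (by linarith) (Real.exp_pos _).le
      _ = 1 := by rw [← Real.exp_add]; simp
  have h6 : Real.exp (-s) * (z - d / σ) ^ σ * (1 + s + d) ≤ z ^ σ := by
    calc Real.exp (-s) * (z - d / σ) ^ σ * (1 + s + d)
        ≤ Real.exp (-s) * (z - d / σ) ^ σ * ((1 + s) * (1 + d)) := by
          refine mul_le_mul_of_nonneg_left ?_ (mul_nonneg (Real.exp_pos _).le h3)
          nlinarith
      _ = (Real.exp (-s) * (1 + s)) * ((z - d / σ) ^ σ * (1 + d)) := by ring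
      _ ≤ 1 * z ^ σ := mul_le_mul h5 h4 (by positivity) zero_le_one
      _ = z ^ σ := one_mul _
  have h7 : z ^ σ * ((s + d) / (1 + s + d)) = z ^ σ - z ^ σ / (1 + s + d) := by
    field_simp
    ring
  rw [h7]
  have h8 : Real.exp (-s) * (z - d / σ) ^ σ ≤ z ^ σ / (1 + s + d) := by
    rw [le_div_iff₀ (by positivity)]
    exact h6
  linarith

/-- Each generation adds ρ² to d, up to losses of relative size Aρ + v, where v stands for ρ² + d.
While d is at most of order ερ these losses consume at most half of the gain, so the lower bound
grows by ρ²/2 per step until it reaches ερ/2. -/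
theorem le_of_criticality_step {A ε ρ q : ℝ} {d : ℕ → ℝ} (hA : 1 ≤ A) (hε : ε = 1 / (8 * A))
    (hρ : 0 < ρ) (hρε : ρ ≤ ε) (hq : 1 - A * ρ ≤ q) (h0 : q * (ρ ^ 2 / (1 + ρ ^ 2)) ≤ d 0)
    (hstep : ∀ k, q * ((ρ ^ 2 + d k) / (1 + ρ ^ 2 + d k)) ≤ d (k + 1)) (k : ℕ) :
    ρ ^ 2 / 2 * min ((k : ℝ) + 1) (ε / ρ) ≤ d k := by
  have hAε : A * ε = 1 / 8 := by rw [hε]; field_simp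
  have hε8 : ε ≤ 1 / 8 := by
    rw [hε]
    exact div_le_div_of_nonneg_left (by norm_num) (by norm_num) (by linarith)
  have hAρ : A * ρ ≤ 1 / 8 := by
    rw [← hAε]
    exact mul_le_mul_of_nonneg_left hρε (by linarith)
  have hM1 : 1 ≤ ε / ρ := by rwa [one_le_div hρ]
  have hfrac : ∀ v : ℝ, 0 ≤ v → v ≤ 1 → v * (1 - A * ρ - v) ≤ q * (v / (1 + v)) := by
    intro v hv hv1
    have h1 : v * (1 - v) ≤ v / (1 + v) := by
      rw [le_div_iff₀ (by linarith)]
      nlinarith [mul_nonneg hv (mul_nonneg hv hv)]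
    have hA0 : 0 ≤ A * ρ := by positivity
    calc v * (1 - A * ρ - v) ≤ (1 - A * ρ) * (v * (1 - v)) := by
          nlinarith [mul_nonneg hA0 (mul_nonneg hv hv)]
      _ ≤ q * (v / (1 + v)) :=
          mul_le_mul hq h1 (mul_nonneg hv (by linarith)) (le_trans (by linarith) hq)
  have hq0 : 0 ≤ q := le_trans (by linarith) hq
  induction k with
  | zero =>
    refine le_trans ?_ h0
    have h1 : ρ ^ 2 ≤ 1 / 64 := by nlinarith
    refine le_trans ?_ (hfrac (ρ ^ 2) (by positivity) (by linarith))
    have h2 : min (((0 : ℕ) : ℝ) + 1) (ε / ρ) ≤ 1 := by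
      refine (min_le_left _ _).trans ?_
      simp
    have h3 := mul_le_mul_of_nonneg_left h2 (by positivity : (0 : ℝ) ≤ ρ ^ 2 / 2)
    have h4 : ρ ^ 2 * (1 / 2) ≤ ρ ^ 2 * (1 - A * ρ - ρ ^ 2) :=
      mul_le_mul_of_nonneg_left (by linarith) (by positivity)
    linarith
  | succ k ih =>
    refine le_trans ?_ (hstep k)
    set m := min ((k : ℝ) + 1) (ε / ρ) with hm
    have hm0 : 0 ≤ m := le_min (by positivity) (by positivity)
    have hmM : m ≤ ε / ρ := min_le_right _ _
    have hm1 : min (((k + 1 : ℕ) : ℝ) + 1) (ε / ρ) ≤ m + 1 := by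
      push_cast
      rw [hm, min_def, min_def]
      split_ifs <;> linarith
    set v := ρ ^ 2 * (1 + m / 2) with hv
    have hv0 : 0 ≤ v := by positivity
    have hmρ : m * ρ ≤ ε := by rwa [le_div_iff₀ hρ] at hmM
    have h1m : (1 + m / 2) * ρ ≤ 2 * ε := by nlinarith
    have hv2 : v ≤ 2 * ε * ρ := by
      rw [hv]
      have := mul_le_mul_of_nonneg_right h1m hρ.le
      linarith
    have hv1 : v ≤ 1 := by nlinarith
    have hkey : (1 + m / 2) * (A * ρ + v) ≤ 1 / 2 := by
      have h1 : (1 + m / 2) * (A * ρ + v) ≤ (1 + m / 2) * ((A + 2 * ε) * ρ) :=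
        mul_le_mul_of_nonneg_left (by linarith) (by positivity)
      have h2 : (1 + m / 2) * ((A + 2 * ε) * ρ) ≤ (A + 2 * ε) * (2 * ε) := by
        have := mul_le_mul_of_nonneg_left h1m (by linarith : (0 : ℝ) ≤ A + 2 * ε)
        linarith
      have h3 : (A + 2 * ε) * (2 * ε) ≤ 1 / 2 := by nlinarith
      linarith
    have hmono : v / (1 + v) ≤ (ρ ^ 2 + d k) / (1 + ρ ^ 2 + d k) := by
      have hvd : v ≤ ρ ^ 2 + d k := by
        rw [hv]
        linarith
      rw [div_le_div_iff₀ (by linarith) (by linarith)]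
      nlinarith
    calc ρ ^ 2 / 2 * min (((k + 1 : ℕ) : ℝ) + 1) (ε / ρ) ≤ ρ ^ 2 / 2 * (m + 1) :=
          mul_le_mul_of_nonneg_left hm1 (by positivity)
      _ ≤ v * (1 - A * ρ - v) := by
          have : ρ ^ 2 * ((1 + m / 2) * (A * ρ + v)) ≤ ρ ^ 2 * (1 / 2) :=
            mul_le_mul_of_nonneg_left hkey (by positivity)
          have h : v * (1 - A * ρ - v) = v - ρ ^ 2 * ((1 + m / 2) * (A * ρ + v)) := by
            rw [hv]
            ring
          rw [h]
          linarith
      _ ≤ q * (v / (1 + v)) := hfrac v hv0 hv1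
      _ ≤ _ := mul_le_mul_of_nonneg_left hmono hq0

section

variable [NeZero σ]

/-- The admissible range of the square root of the Laplace parameter. -/
noncomputable def laplaceRange (σ : ℕ) : ℝ := 1 / (8 * σ ^ 3)

/-- An upper bound for the Laplace functional of an off-backbone branch. -/
noncomputable def branchBound (σ : ℕ) (ρ x : ℝ) : ℝ≥0∞ :=
  if x - 1 / σ ≤ ρ then ENNReal.ofReal (1 - laplaceRange σ / (2 * σ) * ρ) else 1

/-- Let q = z^σ be the probability that the threshold exceeds x, and d_k the mean of 1 - exp(-ρ²
`criticalSize` k) on that event. Then d_{k+1} = q - e^{-ρ²} (z - d_k/σ)^σ, and q ≥ 1 - σ³ρ near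
criticality, so r generations bring d_r to order ρ. This is the square-root singularity of the total
progeny of a critical branching process. -/
theorem closedMean_branchLaplace_le (hσ : 2 ≤ σ) {ρ : ℝ} (hρ : 0 < ρ) (hρε : ρ ≤ laplaceRange σ)
    {r : ℕ} (hr : laplaceRange σ / ρ ≤ r + 1) {x : ℝ} (hx : 1 / (σ : ℝ) < x) (hx1 : x ≤ 1) :
    closedMean (branchLaplace (σ := σ) (ρ ^ 2) r) x ≤
      branchBound σ ρ x * closedMean (1 : unitInterval × Weights σ → ℝ≥0∞) x := by
  have hle1 : closedMean (branchLaplace (σ := σ) (ρ ^ 2) r) x ≤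
      closedMean (1 : unitInterval × Weights σ → ℝ≥0∞) x := by
    refine lintegral_mono fun z => ?_
    exact Set.indicator_le_indicator (branchLaplace_le_one (by positivity) r z)
  rw [branchBound]
  split_ifs with hδ
  swap
  · rwa [one_mul]
  have hσ0 : (0 : ℝ) < σ := Nat.cast_pos.2 (NeZero.pos σ)
  have hx0 : 0 < x := lt_trans (by positivity) hx
  have hσ1 : (1 : ℝ) ≤ σ := by exact_mod_cast NeZero.one_le
  set ε := laplaceRange σ with hε
  set s := ρ ^ 2 with hs
  have hS : MeasurableSet {w : Weights σ | x < threshold w} :=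
    measurableSet_lt measurable_const measurable_threshold
  set q := 1 - percProb σ x with hq
  set z := 1 - x * percProb σ x with hz
  have hqz : q = z ^ σ := by
    have := percProb_eq (σ := σ) hx0.le hx1
    rw [hq, hz]
    linarith
  have hqA : 1 - (σ : ℝ) ^ 3 * ρ ≤ q := by
    have h1 := percProb_sub_le (σ := σ) hσ hx.le
    rw [percProb_inv hσ] at h1
    have h2 : (σ : ℝ) ^ 3 * (x - 1 / σ) ≤ σ ^ 3 * ρ := mul_le_mul_of_nonneg_left hδ (by positivity)
    linarith
  have hσ3 : (1 : ℝ) ≤ (σ : ℝ) ^ 3 := one_le_pow₀ hσ1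
  have hσρ : (σ : ℝ) ^ 3 * ρ ≤ 1 / 8 := by
    have h1 := mul_le_mul_of_nonneg_left hρε (by positivity : (0 : ℝ) ≤ (σ : ℝ) ^ 3)
    have h2 : (σ : ℝ) ^ 3 * ε = 1 / 8 := by
      rw [hε, laplaceRange]
      field_simp
    linarith
  have hp1 := percProb_le_one (σ := σ) x
  have hp0 := percProb_nonneg (σ := σ) x
  have hz1 : z ≤ 1 := by
    have := mul_nonneg hx0.le hp0
    linarith
  have hqpos : 0 < q := by linarith
  have hz0 : 0 < z := by
    have h := mul_le_of_le_one_left hp0 hx1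
    linarith
  have hmass : treeMeasure σ {w | x < threshold w} = ENNReal.ofReal q := by
    rw [hq, ← measureReal_lt_threshold, ofReal_measureReal]
  have hone : closedMean (1 : unitInterval × Weights σ → ℝ≥0∞) x = ENNReal.ofReal z := by
    have hC : MeasurableSet {z : unitInterval × Weights σ | cross z ≤ x} :=
      measurableSet_le measurable_cross measurable_const
    have hCc : {z : unitInterval × Weights σ | x < cross z} =
        {z : unitInterval × Weights σ | cross z ≤ x}ᶜ := by
      ext z
      simp
    rw [closedMean, hCc, lintegral_indicator_one hC.compl, hz, ← measureReal_cross_le hx0.le hx1,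
      ← probReal_compl_eq_one_sub hC, ofReal_measureReal]
  set B : ℕ → ℝ≥0∞ := fun k =>
    ∫⁻ w in {w | x < threshold w}, criticalLaplace s k w ∂treeMeasure σ with hB
  have hBle : ∀ k, B k ≤ ENNReal.ofReal q := by
    intro k
    rw [← hmass]
    calc B k ≤ ∫⁻ w in {w | x < threshold w}, 1 ∂treeMeasure σ :=
          lintegral_mono fun w => criticalLaplace_le_one (by positivity) k w
      _ = _ := by simp
  have hBtop : ∀ k, B k ≠ ⊤ := fun k => ne_top_of_le_ne_top ENNReal.ofReal_ne_top (hBle k)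
  have hBq : ∀ k, (B k).toReal ≤ q := fun k => ENNReal.toReal_le_of_le_ofReal hqpos.le (hBle k)
  have hmean : ∀ k, (closedMean (branchLaplace (σ := σ) s k) x).toReal =
      z - (q - (B k).toReal) / σ := by
    intro k
    have h := closedMean_branchLaplace_add (σ := σ) s k hx.le
    rw [hone, hmass] at h
    have hfin : closedMean (branchLaplace (σ := σ) s k) x ≠ ⊤ := by
      refine ne_top_of_le_ne_top (b := ENNReal.ofReal z) ENNReal.ofReal_ne_top ?_
      rw [← hone]
      refine lintegral_mono fun z => ?_
      exact Set.indicator_le_indicator (branchLaplace_le_one (by positivity) k z)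
    have h2 := congrArg ENNReal.toReal h
    rw [ENNReal.toReal_add hfin (by finiteness), ENNReal.toReal_add (by finiteness)
      (ENNReal.mul_ne_top (by finiteness) (hBtop k)), ENNReal.toReal_mul, ENNReal.toReal_mul,
      ENNReal.toReal_ofReal (by positivity), ENNReal.toReal_ofReal hqpos.le,
      ENNReal.toReal_ofReal hz0.le] at h2
    have h3 : (q - (B k).toReal) / σ = 1 / σ * q - 1 / σ * (B k).toReal := by ring
    rw [h3]
    linarith
  have hd := le_of_criticality_step (A := (σ : ℝ) ^ 3) (ε := ε) (ρ := ρ) (q := q)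
    (d := fun k => q - (B k).toReal) hσ3 hε hρ hρε hqA
    (by
      have h0 : B 0 = ENNReal.ofReal (Real.exp (-s)) * ENNReal.ofReal q := by
        rw [← hmass]
        simp [hB, criticalLaplace, criticalSize]
      simp only [h0]
      rw [ENNReal.toReal_mul, ENNReal.toReal_ofReal (Real.exp_pos _).le,
        ENNReal.toReal_ofReal hqpos.le]
      have h := criticality_step (σ := σ) (d := 0) (s := s) hz0 hz1 le_rfl (by positivity)
        (by positivity) NeZero.one_le
      simp only [add_zero, zero_div, sub_zero] at h
      rw [← hqz] at h
      exact h)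
    (fun k => by
      have h := criticality_step (σ := σ) (d := q - (B k).toReal) (s := s) hz0 hz1
        (by linarith [hBq k]) (by rw [← hqz]; linarith [ENNReal.toReal_nonneg (a := B k)])
        (by positivity) NeZero.one_le
      have h2 : (B (k + 1)).toReal = Real.exp (-s) * (z - (q - (B k).toReal) / σ) ^ σ := by
        simp only [hB]
        rw [setLIntegral_criticalLaplace_succ, ENNReal.toReal_mul, ENNReal.toReal_pow, hmean,
          ENNReal.toReal_ofReal (Real.exp_pos _).le]
      rw [← hqz] at h
      simp only [h2]
      exact h) r
  rw [min_eq_right hr] at hd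
  have hd2 : ε * ρ / 2 ≤ q - (B r).toReal := by
    refine le_trans (le_of_eq ?_) hd
    field_simp
  have hε0 : 0 < ε := by
    rw [hε, laplaceRange]
    positivity
  have hfinal : (closedMean (branchLaplace (σ := σ) s r) x).toReal ≤
      (1 - ε / (2 * σ) * ρ) * z := by
    rw [hmean]
    have h1 : ε * ρ / 2 / σ ≤ (q - (B r).toReal) / σ := div_le_div_of_nonneg_right hd2 hσ0.le
    have h2 : ε * ρ / 2 / σ = ε / (2 * σ) * ρ := by field_simp
    have h3 : ε / (2 * σ) * ρ * z ≤ ε / (2 * σ) * ρ := mul_le_of_le_one_right (by positivity) hz1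
    rw [h2] at h1
    linarith
  rw [hone, ← ENNReal.ofReal_mul' hz0.le]
  refine (ENNReal.le_ofReal_iff_toReal_le ?_ (ENNReal.toReal_nonneg.trans hfinal)).2 hfinal
  exact ne_top_of_le_ne_top (by rw [hone]; exact ENNReal.ofReal_ne_top) hle1

omit [NeZero σ] in
theorem branchBound_monotone {ρ : ℝ} (hρ : 0 ≤ ρ) : Monotone (branchBound σ ρ) := by
  intro x y hxy
  unfold branchBound
  have h : 0 ≤ laplaceRange σ / (2 * σ) * ρ := by
    unfold laplaceRange
    positivity
  have h1 : ENNReal.ofReal (1 - laplaceRange σ / (2 * σ) * ρ) ≤ 1 :=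
    ENNReal.ofReal_le_one.2 (by linarith)
  split_ifs with h2 h3
  · exact le_rfl
  · exact h1
  · exact absurd (by linarith) h2
  · exact le_rfl

omit [NeZero σ] in
theorem branchBound_le_one {ρ : ℝ} (hρ : 0 ≤ ρ) (x : ℝ) : branchBound σ ρ x ≤ 1 := by
  have h := branchBound_monotone (σ := σ) hρ (le_max_left x (1 / σ + ρ + 1))
  refine h.trans (le_of_eq ?_)
  rw [branchBound, if_neg]
  have := le_max_right x (1 / σ + ρ + 1)
  linarith

end

/-! ### Deterministic properties of the invasion -/

theorem invaded_subset_succ (w : Edge σ → ℝ) (N : ℕ) : invaded w N ⊆ invaded w (N + 1) :=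
  Set.subset_union_left

theorem invaded_mono (w : Edge σ → ℝ) : Monotone (invaded w) :=
  monotone_nat_of_le_succ (invaded_subset_succ w)

theorem root_mem_invaded (w : Edge σ → ℝ) (N : ℕ) : [] ∈ invaded w N :=
  invaded_mono w (Nat.zero_le N) rfl

theorem mem_invaded_succ_of_cons {w : Edge σ → ℝ} {N : ℕ} {i : Fin σ} {v : Vertex σ}
    (h : i :: v ∈ invaded w (N + 1)) (h' : i :: v ∉ invaded w N) :
    v ∈ invaded w N ∧ ∀ f ∈ boundary (invaded w N), w (v, i) ≤ w f := by
  obtain h | ⟨⟨u, j⟩, he, hmin, huj⟩ := h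
  · exact absurd h h'
  · obtain ⟨rfl, rfl⟩ : i = j ∧ v = u := by simpa [Edge.top] using huj
    exact ⟨he.1, hmin⟩

theorem parent_mem_invaded {w : Edge σ → ℝ} {N : ℕ} {i : Fin σ} {v : Vertex σ}
    (h : i :: v ∈ invaded w N) : v ∈ invaded w N := by
  induction N with
  | zero => simp [invaded] at h
  | succ N ih =>
    by_cases h' : i :: v ∈ invaded w N
    · exact invaded_subset_succ w N (ih h')
    · exact invaded_subset_succ w N (mem_invaded_succ_of_cons h h').1

theorem ancestor_mem_invaded {w : Edge σ → ℝ} {N : ℕ} (u : Vertex σ) {v : Vertex σ}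
    (h : u ++ v ∈ invaded w N) : v ∈ invaded w N := by
  induction u with
  | nil => exact h
  | cons i u ih => exact ih (parent_mem_invaded h)

theorem ancestor_mem_cluster {w : Edge σ → ℝ} (u : Vertex σ) {v : Vertex σ}
    (h : u ++ v ∈ cluster w) : v ∈ cluster w := by
  obtain ⟨N, hN⟩ := Set.mem_iUnion.1 h
  exact Set.mem_iUnion.2 ⟨N, ancestor_mem_invaded u hN⟩

theorem exists_invasion_time {w : Edge σ → ℝ} {i : Fin σ} {v : Vertex σ}
    (h : i :: v ∈ cluster w) :
    ∃ N, v ∈ invaded w N ∧ i :: v ∈ invaded w (N + 1) ∧ i :: v ∉ invaded w N ∧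
      ∀ f ∈ boundary (invaded w N), w (v, i) ≤ w f := by
  classical
  have h := Set.mem_iUnion.1 h
  obtain ⟨N, hN⟩ : ∃ N, Nat.find h = N + 1 := by
    refine Nat.exists_eq_succ_of_ne_zero fun h0 => ?_
    have := Nat.find_spec h
    rw [h0] at this
    simp [invaded] at this
  have h1 : i :: v ∈ invaded w (N + 1) := hN ▸ Nat.find_spec h
  have h2 : i :: v ∉ invaded w N := Nat.find_min h (by omega)
  obtain ⟨h3, h4⟩ := mem_invaded_succ_of_cons h1 h2
  exact ⟨N, h3, h1, h2, h4⟩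

theorem finite_boundary {S : Set (Vertex σ)} (hS : S.Finite) : (boundary S).Finite :=
  (hS.prod (Set.finite_univ (α := Fin σ))).subset fun _ he => ⟨he.1, trivial⟩

theorem finite_invaded (w : Edge σ → ℝ) (N : ℕ) : (invaded w N).Finite := by
  induction N with
  | zero => exact Set.finite_singleton _
  | succ N ih =>
    refine ih.union (((finite_boundary ih).image Edge.top).subset ?_)
    rintro v ⟨e, he, -, rfl⟩
    exact ⟨e, he, rfl⟩

section

variable [NeZero σ]

theorem boundary_nonempty {S : Set (Vertex σ)} (hS : S.Finite) (h : [] ∈ S) :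
    (boundary S).Nonempty := by
  obtain ⟨v, hv, hmax⟩ := hS.exists_maximalFor List.length S ⟨[], h⟩
  refine ⟨(v, 0), hv, fun hc => ?_⟩
  have := hmax hc (by simp [Edge.top])
  simp [Edge.top] at this

theorem exists_mem_invaded_succ (w : Edge σ → ℝ) (N : ℕ) :
    ∃ v ∈ invaded w (N + 1), v ∉ invaded w N := by
  have hfin := finite_invaded w N
  obtain ⟨e, he, hmin⟩ := (finite_boundary hfin).exists_minimalFor w _
    (boundary_nonempty hfin (root_mem_invaded w N))
  refine ⟨e.top, Or.inr ⟨e, he, fun f hf => ?_, rfl⟩, he.2⟩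
  rcases le_total (w e) (w f) with h | h
  · exact h
  · exact hmin hf h

theorem infinite_cluster (w : Edge σ → ℝ) : (cluster w).Infinite := by
  have hstrict : StrictMono (invaded w) := strictMono_nat_of_lt_succ fun N => by
    obtain ⟨v, hv, hv'⟩ := exists_mem_invaded_succ w N
    exact ⟨invaded_subset_succ w N, fun h => hv' (h hv)⟩
  intro hfin
  have hf : (Set.range (invaded w)).Finite := hfin.finite_subsets.subset (by
    rintro _ ⟨N, rfl⟩
    exact Set.subset_iUnion _ N)
  exact Set.infinite_range_of_injective hstrict.injective hf

end

/-! ### The backbone for regular weights -/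

/-- The almost sure properties of the weights used in the description of the cluster. -/
structure Regular (w : Weights σ) : Prop where
  supercritical : ∀ v, 1 / (σ : ℝ) < threshold (shift v w)
  unique_min : ∀ v, ∃ i, ∀ j, j ≠ i →
    cross (branch (shift v w) i) < cross (branch (shift v w) j)

theorem branch_shift (v : Vertex σ) (w : Weights σ) (i : Fin σ) :
    branch (shift v w) i = (w (v, i), shift (i :: v) w) := by
  rw [branch, shift_shift]
  rfl

/-- The child through which a vertex is connected to infinity at the smallest level. -/
noncomputable def Regular.next {w : Weights σ} (hw : Regular w) (v : Vertex σ) : Fin σ :=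
  (hw.unique_min v).choose

/-- The backbone of the invasion percolation cluster. -/
noncomputable def Regular.backbone {w : Weights σ} (hw : Regular w) : ℕ → Vertex σ
  | 0 => []
  | k + 1 => hw.next (hw.backbone k) :: hw.backbone k

theorem Regular.cross_next_lt {w : Weights σ} (hw : Regular w) (v : Vertex σ) {j : Fin σ}
    (hj : j ≠ hw.next v) :
    cross (branch (shift v w) (hw.next v)) < cross (branch (shift v w) j) :=
  (hw.unique_min v).choose_spec j hj

theorem Regular.length_backbone {w : Weights σ} (hw : Regular w) (k : ℕ) :
    (hw.backbone k).length = k := by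
  induction k with
  | zero => rfl
  | succ k ih => rw [Regular.backbone, List.length_cons, ih]

theorem Regular.backbone_injective {w : Weights σ} (hw : Regular w) :
    Function.Injective hw.backbone := fun j k h => by
  rw [← hw.length_backbone j, h, hw.length_backbone]

section

variable [NeZero σ] {w : Weights σ} (hw : Regular w)

theorem Regular.threshold_eq (v : Vertex σ) :
    threshold (shift v w) = cross (branch (shift v w) (hw.next v)) :=
  threshold_eq_cross fun _ hj => hw.cross_next_lt v hj

theorem Regular.threshold_backbone_succ_le (k : ℕ) :
    threshold (shift (hw.backbone (k + 1)) w) ≤ threshold (shift (hw.backbone k) w) := by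
  rw [hw.threshold_eq (hw.backbone k), branch_shift]
  exact le_max_right _ _

theorem Regular.threshold_backbone_antitone :
    Antitone fun k => threshold (shift (hw.backbone k) w) :=
  antitone_nat_of_succ_le hw.threshold_backbone_succ_le

theorem Regular.weight_backbone_le (k : ℕ) :
    (w (hw.backbone k, hw.next (hw.backbone k)) : ℝ) ≤ threshold (shift (hw.backbone k) w) := by
  rw [hw.threshold_eq (hw.backbone k), branch_shift]
  exact le_max_left _ _

end

/-! ### Volume above the backbone -/

/-- The number of vertices of `A` that lie above `v`, at distance at most `h` from `v`. -/
noncomputable def countAbove (A : Set (Vertex σ)) (v : Vertex σ) (h : ℕ) : ℕ :=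
  {u : Vertex σ | u ++ v ∈ A ∧ u.length ≤ h}.ncard

theorem finite_above (A : Set (Vertex σ)) (v : Vertex σ) (h : ℕ) :
    {u : Vertex σ | u ++ v ∈ A ∧ u.length ≤ h}.Finite :=
  (List.finite_length_le (Fin σ) h).subset fun _ hu => hu.2

theorem countAbove_mono (A : Set (Vertex σ)) (v : Vertex σ) : Monotone (countAbove A v) :=
  fun _ k hhk => Set.ncard_le_ncard (fun _ hu => ⟨hu.1, hu.2.trans hhk⟩) (finite_above A v k)

theorem sum_countAbove_le (A : Set (Vertex σ)) {v : Vertex σ} (hv : v ∈ A) (h : ℕ) :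
    1 + ∑ i, countAbove A (i :: v) h ≤ countAbove A v (h + 1) := by
  classical
  set F : Fin σ → Finset (Vertex σ) := fun i => (finite_above A (i :: v) h).toFinset with hF
  have hFc : ∀ i, countAbove A (i :: v) h = (F i).card := fun i =>
    Set.ncard_eq_toFinset_card _ (finite_above A (i :: v) h)
  have hinj : ∀ i : Fin σ, Function.Injective fun u : Vertex σ => u ++ [i] := fun i =>
    List.append_left_injective [i]
  have hdisj : ((Finset.univ : Finset (Fin σ)) : Set (Fin σ)).PairwiseDisjoint
      fun i => (F i).image fun u => u ++ [i] := by
    intro i _ j _ hij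
    refine Finset.disjoint_left.2 fun x hx hx' => ?_
    obtain ⟨u, -, rfl⟩ := Finset.mem_image.1 hx
    obtain ⟨u', -, hu'⟩ := Finset.mem_image.1 hx'
    exact hij (by simpa using (List.append_inj' hu' rfl).2.symm)
  have hnil : [] ∉ Finset.univ.biUnion fun i => (F i).image fun u => u ++ [i] := by simp
  have hsub : insert [] (Finset.univ.biUnion fun i => (F i).image fun u => u ++ [i]) ⊆
      (finite_above A v (h + 1)).toFinset := by
    intro x hx
    rw [Set.Finite.mem_toFinset]
    rcases Finset.mem_insert.1 hx with rfl | hx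
    · exact ⟨hv, by simp⟩
    · obtain ⟨i, -, hx⟩ := Finset.mem_biUnion.1 hx
      obtain ⟨u, hu, rfl⟩ := Finset.mem_image.1 hx
      rw [hF, Set.Finite.mem_toFinset] at hu
      exact ⟨by simpa using hu.1, by simpa using hu.2⟩
  have := Finset.card_le_card hsub
  rw [Finset.card_insert_of_notMem hnil, Finset.card_biUnion hdisj] at this
  simp only [Finset.card_image_of_injective _ (hinj _)] at this
  rw [countAbove, Set.ncard_eq_toFinset_card _ (finite_above A v (h + 1))]
  simp only [hFc]
  omega

theorem criticalSize_le_countAbove {w : Weights σ} {A : Set (Vertex σ)}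
    (hA : ∀ v ∈ A, ∀ i, (w (v, i) : ℝ) ≤ 1 / σ → i :: v ∈ A) (r : ℕ) {v : Vertex σ}
    (hv : v ∈ A) : criticalSize r (shift v w) ≤ countAbove A v r := by
  induction r generalizing v with
  | zero =>
    rw [criticalSize, countAbove, Nat.one_le_iff_ne_zero]
    exact Set.ncard_ne_zero_of_mem (a := []) ⟨hv, le_rfl⟩ (finite_above A v 0)
  | succ r ih =>
    refine le_trans ?_ (sum_countAbove_le A hv r)
    rw [criticalSize]
    refine Nat.add_le_add_left (Finset.sum_le_sum fun i _ => ?_) 1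
    split_ifs with h
    · rw [shift_shift]
      exact ih (hA v hv i h)
    · exact Nat.zero_le _

section

variable [NeZero σ] {w : Weights σ}

theorem level_le_of_path {x : ℝ} (u v : Vertex σ)
    (h : ∀ u' i, i :: u' <:+ u → (w (u' ++ v, i) : ℝ) ≤ x) (hx : 0 ≤ x) :
    (level u.length (shift v w) : ℝ) ≤ x := by
  -- Words list the root end last, so the last letter is the first step of the path away from `v`.
  induction u using List.reverseRecOn generalizing v with
  | nil => exact hx
  | append_singleton u j ih =>
    rw [List.length_append, List.length_singleton, level_succ_le_iff]
    refine ⟨j, h [] j (List.suffix_append u [j]), ?_⟩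
    rw [shift_shift]
    refine ih ([j] ++ v) fun u' i hu => ?_
    rw [← List.append_assoc]
    refine h (u' ++ [j]) i ?_
    obtain ⟨t, rfl⟩ := hu
    exact ⟨t, by simp⟩

variable (hw : Regular w)

omit [NeZero σ] in
theorem Regular.exists_backbone_boundary {S : Set (Vertex σ)} (hS : S.Finite) {k : ℕ}
    (hk : hw.backbone k ∈ S) :
    ∃ j, k ≤ j ∧ (hw.backbone j, hw.next (hw.backbone j)) ∈ boundary S := by
  by_contra! hc
  have hall : ∀ j, k ≤ j → hw.backbone j ∈ S := by
    intro j hj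
    induction j, hj using Nat.le_induction with
    | base => exact hk
    | succ j hj ih =>
      by_contra hn
      exact hc j hj ⟨ih, hn⟩
  refine Set.infinite_of_injective_forall_mem (f := fun j => hw.backbone (k + j)) ?_
    (fun j => hall _ (Nat.le_add_right k j)) hS
  intro i j hij
  have := hw.backbone_injective hij
  omega

/-- When the edge is invaded, the k-th backbone vertex is already present, and a finite set cannot
contain the whole backbone. So a backbone edge at some height j ≥ k competes, with weight at most
the threshold at j, hence at most that at k. -/
theorem Regular.weight_le_of_mem_cluster {k : ℕ} {u : Vertex σ} {i : Fin σ}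
    (h : i :: (u ++ hw.backbone k) ∈ cluster fun e => (w e : ℝ)) :
    (w (u ++ hw.backbone k, i) : ℝ) ≤ threshold (shift (hw.backbone k) w) := by
  obtain ⟨N, h1, -, -, h4⟩ := exists_invasion_time h
  obtain ⟨j, hj, hb⟩ := hw.exists_backbone_boundary (finite_invaded _ N) (ancestor_mem_invaded u h1)
  exact (h4 _ hb).trans ((hw.weight_backbone_le j).trans (hw.threshold_backbone_antitone hj))

/-- By pigeonhole the invasion is infinite above some child. All edges it uses there weigh at most
the current threshold, so the `cross` of that child is at most this threshold; by uniqueness of the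
minimizer it is the backbone child. -/
theorem Regular.infinite_above_backbone (k : ℕ) :
    {u | u ++ hw.backbone k ∈ cluster fun e => (w e : ℝ)}.Infinite := by
  induction k with
  | zero => simpa [Regular.backbone] using infinite_cluster fun e => (w e : ℝ)
  | succ k ih =>
    set C := cluster fun e => (w e : ℝ) with hC
    set b := hw.backbone k with hb
    have hsub : {u | u ++ b ∈ C} ⊆
        {[]} ∪ ⋃ i, (fun u => u ++ [i]) '' {u | u ++ i :: b ∈ C} := by
      intro u hu
      rcases List.eq_nil_or_concat u with rfl | ⟨u, i, rfl⟩
      · exact Or.inl rfl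
      · refine Or.inr (Set.mem_iUnion.2 ⟨i, u, ?_, by simp⟩)
        simpa using hu
    obtain ⟨i, hi⟩ : ∃ i, {u | u ++ i :: b ∈ C}.Infinite := by
      by_contra! hc
      refine ih (((Set.finite_singleton _).union (Set.finite_iUnion fun i => ?_)).subset hsub)
      exact (hc i).image _
    have hin : i = hw.next b := by
      by_contra hne
      have hlt := hw.cross_next_lt b hne
      rw [← hw.threshold_eq, branch_shift] at hlt
      refine absurd hlt (not_lt.2 (max_le ?_ ?_))
      · obtain ⟨u, hu⟩ := hi.nonempty
        exact hw.weight_le_of_mem_cluster (u := []) (ancestor_mem_cluster u hu)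
      · refine threshold_le_iff_level.2 fun m => ?_
        obtain ⟨u, hu, hum⟩ : ∃ u, u ++ i :: b ∈ C ∧ m ≤ u.length := by
          by_contra! hc
          exact hi ((List.finite_length_lt (Fin σ) m).subset fun u hu => hc u hu)
        refine (level_mono _ hum).trans (level_le_of_path u (i :: b) (fun u' j hu' => ?_)
          (threshold_nonneg _))
        obtain ⟨t, rfl⟩ := hu'
        have hmem : j :: ((u' ++ [i]) ++ b) ∈ C :=
          ancestor_mem_cluster t (by simpa using hu)
        have := hw.weight_le_of_mem_cluster hmem
        simpa using this
    rw [hin] at hi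
    exact hi

theorem Regular.backbone_mem_cluster (k : ℕ) :
    hw.backbone k ∈ cluster fun e => (w e : ℝ) := by
  obtain ⟨u, hu⟩ := (hw.infinite_above_backbone k).nonempty
  exact ancestor_mem_cluster u hu

/-- An edge of weight at most 1/σ left on the boundary forever would force all later invaded edges
to weigh at most 1/σ. The backbone beyond some height would then percolate at the critical level,
contradicting supercriticality of thresholds. -/
theorem Regular.cluster_closed (hw : Regular w) {v : Vertex σ} (hv : v ∈ cluster fun e => (w e : ℝ)) {i : Fin σ}
    (hi : (w (v, i) : ℝ) ≤ 1 / σ) : i :: v ∈ cluster fun e => (w e : ℝ) := by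
  by_contra hn
  obtain ⟨N₀, hN₀⟩ := Set.mem_iUnion.1 hv
  have hbd : ∀ N, N₀ ≤ N → (v, i) ∈ boundary (invaded (fun e => (w e : ℝ)) N) := fun N hN =>
    ⟨invaded_mono _ hN hN₀, fun h => hn (Set.mem_iUnion.2 ⟨N, h⟩)⟩
  obtain ⟨k, -, hk⟩ := hw.exists_backbone_boundary (k := 0) (finite_invaded _ N₀)
    (root_mem_invaded (fun e => (w e : ℝ)) N₀)
  have hout : ∀ j, k + 1 ≤ j → hw.backbone j ∉ invaded (fun e => (w e : ℝ)) N₀ := by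
    intro j hj
    induction j, hj using Nat.le_induction with
    | base => exact hk.2
    | succ j _ ih => exact fun h => ih (parent_mem_invaded h)
  have hwt : ∀ j, k ≤ j → (w (hw.backbone j, hw.next (hw.backbone j)) : ℝ) ≤ 1 / σ := by
    intro j hj
    obtain ⟨N, -, h2, -, h4⟩ := exists_invasion_time (hw.backbone_mem_cluster (j + 1))
    have hN : N₀ ≤ N := by
      by_contra! hlt
      exact hout (j + 1) (by omega) (invaded_mono _ hlt h2)
    exact (h4 _ (hbd N hN)).trans hi
  have hlevel : ∀ m j, k ≤ j → (level m (shift (hw.backbone j) w) : ℝ) ≤ 1 / σ := by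
    intro m
    induction m with
    | zero =>
      intro j _
      change (0 : ℝ) ≤ 1 / σ
      positivity
    | succ m ih =>
      intro j hj
      rw [level_succ_le_iff]
      refine ⟨hw.next (hw.backbone j), hwt j hj, ?_⟩
      rw [shift_shift]
      exact ih (j + 1) (by omega)
  exact absurd (hw.supercritical (hw.backbone k))
    (not_lt.2 (threshold_le_iff_level.2 fun m => hlevel m k le_rfl))

omit [NeZero σ] in
theorem Regular.peel_backbone {g : unitInterval × Weights σ → ℝ≥0∞} {Φ : Weights σ → ℝ≥0∞}
    (k : ℕ) :
    Φ (shift (hw.backbone (k + 1)) w) * ∏ j ∈ Finset.univ.erase (hw.next (hw.backbone k)),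
        g (branch (shift (hw.backbone k) w) j) ≤ peel g Φ (shift (hw.backbone k) w) := by
  refine le_trans (le_of_eq ?_) (Finset.single_le_sum (fun _ _ => zero_le)
    (Finset.mem_univ (hw.next (hw.backbone k))))
  rw [branch_shift _ _ (hw.next (hw.backbone k))]
  congr 1
  refine Finset.prod_congr rfl fun j hj => ?_
  rw [Set.indicator_of_mem]
  have := hw.cross_next_lt (hw.backbone k) (Finset.ne_of_mem_erase hj)
  rwa [branch_shift _ _ (hw.next (hw.backbone k))] at this

/-- The volume above a vertex is at least the sum over its children, so its exponential is at most a
product. Off the backbone, a branch with root edge at most 1/σ contains its critical cluster, and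
any other branch is bounded trivially by 1. -/
theorem Regular.exp_countAbove_le_iterate_peel {s : ℝ} (hs : 0 ≤ s) (r n k : ℕ) :
    ENNReal.ofReal (Real.exp (-(s * countAbove (cluster fun e => (w e : ℝ)) (hw.backbone k)
      (r + n)))) ≤ (peel (branchLaplace s r))^[n] 1 (shift (hw.backbone k) w) := by
  set C := cluster fun e => (w e : ℝ) with hC
  induction n generalizing k with
  | zero =>
    refine ENNReal.ofReal_le_one.2 (Real.exp_le_one_iff.2 ?_)
    have : 0 ≤ s * countAbove C (hw.backbone k) (r + 0) := by positivity
    linarith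
  | succ n ih =>
    rw [Function.iterate_succ_apply']
    refine le_trans ?_ (hw.peel_backbone k)
    have hbr : ∀ j, ENNReal.ofReal (Real.exp (-(s * countAbove C (j :: hw.backbone k) (r + n)))) ≤
        branchLaplace s r (branch (shift (hw.backbone k) w) j) := by
      intro j
      rw [branch_shift]
      by_cases hj : (w (hw.backbone k, j) : ℝ) ≤ 1 / σ
      · rw [branchLaplace_of_le hj]
        refine ENNReal.ofReal_le_ofReal (Real.exp_le_exp.2 (neg_le_neg ?_))
        have h1 := criticalSize_le_countAbove (fun v hv i hi => hw.cluster_closed hv hi) r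
          (hw.cluster_closed (hw.backbone_mem_cluster k) hj)
        have h2 := h1.trans (countAbove_mono C (j :: hw.backbone k) (Nat.le_add_right r n))
        exact mul_le_mul_of_nonneg_left (by exact_mod_cast h2) hs
      · rw [branchLaplace_of_not_le hj]
        refine ENNReal.ofReal_le_one.2 (Real.exp_le_one_iff.2 ?_)
        have : 0 ≤ s * countAbove C (j :: hw.backbone k) (r + n) := by positivity
        linarith
    refine le_trans ?_ (mul_le_mul' (ih (k + 1)) (Finset.prod_le_prod' fun j _ => hbr j))
    rw [Regular.backbone, Finset.mul_prod_erase Finset.univ (fun j => ENNReal.ofReal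
      (Real.exp (-(s * countAbove C (j :: hw.backbone k) (r + n))))) (Finset.mem_univ _),
      ← ENNReal.ofReal_prod_of_nonneg fun i _ => (Real.exp_pos _).le, ← Real.exp_sum]
    refine ENNReal.ofReal_le_ofReal (Real.exp_le_exp.2 ?_)
    rw [Finset.sum_neg_distrib, ← Finset.mul_sum]
    refine neg_le_neg (mul_le_mul_of_nonneg_left ?_ hs)
    have h := sum_countAbove_le C (hw.backbone_mem_cluster k) (r + n)
    have h2 : ∑ i, countAbove C (i :: hw.backbone k) (r + n) ≤
        countAbove C (hw.backbone k) (r + (n + 1)) := by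
      rw [← Nat.add_assoc]
      omega
    exact_mod_cast h2

/-- The Laplace functional of the cluster volume is bounded by that of the critical clusters
attached to the backbone at heights from `m` to `m + n`. -/
theorem Regular.exp_clusterVolume_le (hw : Regular w) {s : ℝ} (hs : 0 ≤ s) (r n m : ℕ) :
    ENNReal.ofReal (Real.exp (-(s * clusterVolume (fun e => (w e : ℝ)) (r + n + m)))) ≤
      (peel 1)^[m] ((peel (branchLaplace s r))^[n] 1) w := by
  set C := cluster fun e => (w e : ℝ) with hC
  have key : ∀ k, ENNReal.ofReal (Real.exp (-(s * countAbove C (hw.backbone k) (r + n + m)))) ≤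
      (peel 1)^[m] ((peel (branchLaplace s r))^[n] 1) (shift (hw.backbone k) w) := by
    induction m with
    | zero => exact fun k => hw.exp_countAbove_le_iterate_peel hs r n k
    | succ m ih =>
      intro k
      rw [Function.iterate_succ_apply']
      refine le_trans ?_ (hw.peel_backbone k)
      simp only [Pi.one_apply, Finset.prod_const_one, mul_one]
      refine le_trans ?_ (ih (k + 1))
      refine ENNReal.ofReal_le_ofReal (Real.exp_le_exp.2 (neg_le_neg ?_))
      refine mul_le_mul_of_nonneg_left ?_ hs
      have h := sum_countAbove_le C (hw.backbone_mem_cluster k) (r + n + m)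
      have h2 := Finset.single_le_sum (f := fun i => countAbove C (i :: hw.backbone k) (r + n + m))
        (fun _ _ => Nat.zero_le _) (Finset.mem_univ (hw.next (hw.backbone k)))
      have h3 : countAbove C (hw.backbone (k + 1)) (r + n + m) ≤
          countAbove C (hw.backbone k) (r + n + (m + 1)) := by
        rw [← Nat.add_assoc (r + n) m 1]
        rw [Regular.backbone]
        omega
      exact_mod_cast h3
  have h0 := key 0
  have hvol : countAbove C [] (r + n + m) = clusterVolume (fun e => (w e : ℝ)) (r + n + m) := by
    simp only [countAbove, List.append_nil]
    rfl
  rwa [Regular.backbone, shift_nil, hvol] at h0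

end

/-! ### Almost sure regularity -/

/-- The law of `cross` has no atoms, so with branch `i` fixed each other branch avoids its value
almost surely; the product of the indicators integrates to 1. -/
theorem ae_branch_ne [NeZero σ] (hσ : 2 ≤ σ) (i : Fin σ) :
    ∀ᵐ w ∂treeMeasure σ, ∀ j, j ≠ i → cross (branch w j) ≠ cross (branch w i) := by
  have hm : MeasurableSet {p : (unitInterval × Weights σ) × (unitInterval × Weights σ) |
      cross p.2 ≠ cross p.1} :=
    (measurableSet_eq_fun (by fun_prop) (by fun_prop)).compl
  have hH : Measurable fun p : (unitInterval × Weights σ) × (unitInterval × Weights σ) =>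
      {z | cross z ≠ cross p.1}.indicator (1 : unitInterval × Weights σ → ℝ≥0∞) p.2 :=
    measurable_one.indicator hm
  have h1 := lintegral_pi_distinguished (branchMeasure σ) (F := 1) measurable_one
    (H := fun y z => {z | cross z ≠ cross y}.indicator (1 : unitInterval × Weights σ → ℝ≥0∞) z) hH i
  have h2 : ∀ y : unitInterval × Weights σ,
      ∫⁻ z, {z | cross z ≠ cross y}.indicator (1 : unitInterval × Weights σ → ℝ≥0∞) z ∂branchMeasure σ = 1 := by
    intro y
    have hy : MeasurableSet {z : unitInterval × Weights σ | cross z = cross y} :=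
      measurableSet_eq_fun measurable_cross measurable_const
    have : {z : unitInterval × Weights σ | cross z ≠ cross y} = {z | cross z = cross y}ᶜ := rfl
    rw [this, lintegral_indicator_one hy.compl, prob_compl_eq_one_iff hy]
    exact measure_cross_eq hσ _
  simp only [h2, Pi.one_apply, one_mul, one_pow, lintegral_one, measure_univ] at h1
  have hS : MeasurableSet {z : Fin σ → unitInterval × Weights σ |
      ∀ j, j ≠ i → cross (z j) ≠ cross (z i)} := by
    simp only [Set.ofPred_forall]
    refine MeasurableSet.iInter fun j => MeasurableSet.iInter fun _ => ?_
    exact (measurableSet_eq_fun (by fun_prop) (by fun_prop)).compl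
  have h3 : ∀ᵐ z ∂Measure.pi fun _ : Fin σ => branchMeasure σ,
      ∀ j, j ≠ i → cross (z j) ≠ cross (z i) := by
    rw [ae_iff_prob_eq_one (by exact hS.mem)]
    rw [← h1, ← lintegral_indicator_one hS]
    refine lintegral_congr fun z => ?_
    by_cases hz : ∀ j, j ≠ i → cross (z j) ≠ cross (z i)
    · rw [Set.indicator_of_mem (by exact hz)]
      symm
      refine Finset.prod_eq_one fun j hj => ?_
      rw [Set.indicator_of_mem]
      · rfl
      · exact hz j (Finset.ne_of_mem_erase hj)
    · rw [Set.indicator_of_notMem (by exact hz)]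
      push Not at hz
      obtain ⟨j, hj, hji⟩ := hz
      symm
      refine Finset.prod_eq_zero (Finset.mem_erase.2 ⟨hj, Finset.mem_univ j⟩) ?_
      exact Set.indicator_of_notMem (by simpa using hji) _
  exact measurePreserving_branch.quasiMeasurePreserving.ae h3

theorem ae_regular [NeZero σ] (hσ : 2 ≤ σ) : ∀ᵐ w ∂treeMeasure σ, Regular w := by
  have h1 : ∀ᵐ w ∂treeMeasure σ, ∀ v : Vertex σ, 1 / (σ : ℝ) < threshold (shift v w) :=
    ae_all_iff.2 fun v =>
      (measurePreserving_shift v).quasiMeasurePreserving.ae (ae_inv_lt_threshold hσ)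
  have h2 : ∀ᵐ w ∂treeMeasure σ, ∀ (v : Vertex σ) (i j : Fin σ), j ≠ i →
      cross (branch (shift v w) j) ≠ cross (branch (shift v w) i) :=
    ae_all_iff.2 fun v => ae_all_iff.2 fun i =>
      (measurePreserving_shift v).quasiMeasurePreserving.ae (ae_branch_ne hσ i)
  filter_upwards [h1, h2] with w hw1 hw2
  refine ⟨hw1, fun v => ?_⟩
  obtain ⟨i, -, hi⟩ := Finset.exists_min_image (Finset.univ : Finset (Fin σ))
    (fun i => cross (branch (shift v w) i)) Finset.univ_nonempty
  exact ⟨i, fun j hj => lt_of_le_of_ne (hi j (Finset.mem_univ j)) (hw2 v i j hj).symm⟩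

/-! ### Monotonicity and measurability of the volume -/

theorem finite_clusterVolume (w : Edge σ → ℝ) (n : ℕ) :
    {v : Vertex σ | v ∈ cluster w ∧ height v ≤ n}.Finite :=
  (List.finite_length_le (Fin σ) n).subset fun _ hv => hv.2

theorem one_le_clusterVolume (w : Edge σ → ℝ) (n : ℕ) : 1 ≤ clusterVolume w n := by
  rw [clusterVolume, Nat.one_le_iff_ne_zero]
  exact Set.ncard_ne_zero_of_mem (a := [])
    ⟨Set.mem_iUnion.2 ⟨0, rfl⟩, Nat.zero_le n⟩ (finite_clusterVolume w n)

theorem clusterVolume_mono (w : Edge σ → ℝ) : Monotone (clusterVolume w) := fun _ n h =>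
  Set.ncard_le_ncard (fun _ hv => ⟨hv.1, hv.2.trans h⟩) (finite_clusterVolume w n)

theorem measurable_mem_invaded (N : ℕ) (v : Vertex σ) :
    Measurable fun w : Edge σ → ℝ => v ∈ invaded w N := by
  induction N generalizing v with
  | zero => exact measurable_const
  | succ N ih =>
    have hb : ∀ e : Edge σ, Measurable fun w : Edge σ → ℝ => e ∈ boundary (invaded w N) :=
      fun e => (ih e.base).and (ih e.top).not
    refine (ih v).or (Measurable.exists fun e => (hb e).and (Measurable.and
      (Measurable.forall fun f => (hb f).imp ?_) measurable_const))
    exact (measurableSet_le (measurable_pi_apply e) (measurable_pi_apply f)).mem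

theorem measurable_clusterVolume (n : ℕ) :
    Measurable fun w : Edge σ → ℝ => clusterVolume w n := by
  classical
  have hc : ∀ v, Measurable fun w : Edge σ → ℝ => v ∈ cluster w := by
    intro v
    simp only [cluster, Set.mem_iUnion]
    exact Measurable.exists fun N => measurable_mem_invaded N v
  have h : (fun w : Edge σ → ℝ => clusterVolume w n) = fun w =>
      ∑ v ∈ (List.finite_length_le (Fin σ) n).toFinset, if v ∈ cluster w then 1 else 0 := by
    funext w
    rw [← Finset.card_filter, clusterVolume, ← Set.ncard_coe_finset]
    congr 1
    ext v
    simp [height, and_comm]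
  rw [h]
  exact Finset.measurable_sum _ fun v _ =>
    Measurable.ite (hc v).setOf measurable_const measurable_const

/-! ### From Laplace transforms to the inverse volume -/

/-- A discrete representation of the inverse volume as a superposition of exponentials. -/
theorem sq_div_le_sum_exp {ε : ℝ} (hε : 0 < ε) (hε1 : ε ≤ 1) {m : ℕ} (hm : 1 ≤ m) {V : ℝ}
    (hV : 1 ≤ V) :
    (m : ℝ) ^ 2 / V ≤ 1 / ε ^ 2 + 4 * Real.exp 1 / ε ^ 2 *
      ∑ k ∈ Finset.range (⌊ε * m⌋₊ + 1), k * Real.exp (-((k / m : ℝ) ^ 2 * V)) := by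
  have hm0 : (0 : ℝ) < m := by exact_mod_cast hm
  have hV0 : 0 < V := by linarith
  have hsV : 1 ≤ √V := Real.one_le_sqrt.2 hV
  -- For k ≤ K the exponent (k/m)² V is at most ε² ≤ 1, so the sum is at least e⁻¹ ∑ k ≥ e⁻¹ K²/4.
  -- Since V ≥ 1, K does not exceed the summation limit εm.
  set K := ε * m / √V with hK
  have hK0 : 0 < K := by positivity
  have hKsq : K ^ 2 = ε ^ 2 * (m ^ 2 / V) := by
    rw [hK, div_pow, Real.sq_sqrt hV0.le]
    ring
  have hsum0 : 0 ≤ ∑ k ∈ Finset.range (⌊ε * m⌋₊ + 1),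
      (k : ℝ) * Real.exp (-((k / m : ℝ) ^ 2 * V)) := Finset.sum_nonneg fun k _ => by positivity
  have hid : (m : ℝ) ^ 2 / V = K ^ 2 / ε ^ 2 := by
    rw [hKsq]
    field_simp
  rw [hid]
  rcases lt_or_ge K 1 with hK1 | hK1
  · have h1 : K ^ 2 / ε ^ 2 ≤ 1 / ε ^ 2 :=
      div_le_div_of_nonneg_right (by nlinarith) (by positivity)
    have h2 : 0 ≤ 4 * Real.exp 1 / ε ^ 2 := by positivity
    have := mul_nonneg h2 hsum0
    linarith
  · have hsum : K ^ 2 / 4 * Real.exp (-1) ≤ ∑ k ∈ Finset.range (⌊ε * m⌋₊ + 1),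
        (k : ℝ) * Real.exp (-((k / m : ℝ) ^ 2 * V)) := by
      have hL1 : (1 : ℝ) ≤ ⌊K⌋₊ := by exact_mod_cast Nat.le_floor (by exact_mod_cast hK1)
      have hLK : K < ⌊K⌋₊ + 1 := Nat.lt_floor_add_one K
      have hKm : K ≤ ε * m := div_le_self (by positivity) hsV
      have hgauss : (∑ k ∈ Finset.range (⌊K⌋₊ + 1), (k : ℝ)) * 2 = (⌊K⌋₊ + 1) * ⌊K⌋₊ := by
        have := Finset.sum_range_id_mul_two (⌊K⌋₊ + 1)
        rw [Nat.add_sub_cancel] at this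
        have := congrArg (Nat.cast : ℕ → ℝ) this
        push_cast at this
        exact this
      calc K ^ 2 / 4 * Real.exp (-1)
          ≤ (∑ k ∈ Finset.range (⌊K⌋₊ + 1), (k : ℝ)) * Real.exp (-1) := by
            refine mul_le_mul_of_nonneg_right ?_ (Real.exp_pos _).le
            nlinarith
        _ = ∑ k ∈ Finset.range (⌊K⌋₊ + 1), (k : ℝ) * Real.exp (-1) := Finset.sum_mul _ _ _
        _ ≤ ∑ k ∈ Finset.range (⌊K⌋₊ + 1), (k : ℝ) * Real.exp (-((k / m : ℝ) ^ 2 * V)) := by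
            refine Finset.sum_le_sum fun k hk => mul_le_mul_of_nonneg_left
              (Real.exp_le_exp.2 (neg_le_neg ?_)) (Nat.cast_nonneg k)
            have hkK : (k : ℝ) ≤ K := le_trans (by
              exact_mod_cast Nat.lt_succ_iff.1 (Finset.mem_range.1 hk)) (Nat.floor_le hK0.le)
            have hk2 : (k : ℝ) ^ 2 ≤ K ^ 2 := pow_le_pow_left₀ (Nat.cast_nonneg k) hkK 2
            have : (k / m : ℝ) ^ 2 * V ≤ ε ^ 2 := by
              rw [hKsq] at hk2
              calc (k / m : ℝ) ^ 2 * V = (k : ℝ) ^ 2 * (V / m ^ 2) := by ring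
                _ ≤ ε ^ 2 * (m ^ 2 / V) * (V / m ^ 2) :=
                  mul_le_mul_of_nonneg_right hk2 (by positivity)
                _ = ε ^ 2 := by field_simp
            nlinarith
        _ ≤ _ := by
            refine Finset.sum_le_sum_of_subset_of_nonneg ?_ fun k _ _ => by positivity
            exact Finset.range_mono (Nat.add_le_add_right (Nat.floor_mono hKm) 1)
    have h2 : K ^ 2 / ε ^ 2 = 4 * Real.exp 1 / ε ^ 2 * (K ^ 2 / 4 * Real.exp (-1)) := by
      rw [Real.exp_neg]
      field_simp
    have h3 : 4 * Real.exp 1 / ε ^ 2 * (K ^ 2 / 4 * Real.exp (-1)) ≤ _ :=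
      mul_le_mul_of_nonneg_left hsum (by positivity : 0 ≤ 4 * Real.exp 1 / ε ^ 2)
    have h4 : 0 ≤ 1 / ε ^ 2 := by positivity
    linarith

theorem sum_ite_lt_le_sq {x : ℝ} (hx : 0 ≤ x) (N : ℕ) :
    ∑ k ∈ Finset.range N, (if (k : ℝ) < x then (k : ℝ) else 0) ≤ x ^ 2 := by
  calc ∑ k ∈ Finset.range N, (if (k : ℝ) < x then (k : ℝ) else 0)
      ≤ ∑ k ∈ Finset.range N, (if k ∈ Finset.Icc 1 ⌊x⌋₊ then x else 0) := by
        refine Finset.sum_le_sum fun k _ => ?_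
        rcases Nat.eq_zero_or_pos k with rfl | hk
        · simp
        · split_ifs with h1 h2 h2
          · exact h1.le
          · exact absurd (Finset.mem_Icc.2 ⟨hk, Nat.le_floor h1.le⟩) h2
          · exact hx
          · exact le_rfl
    _ ≤ ∑ k ∈ Finset.Icc 1 ⌊x⌋₊, x := by
        rw [← Finset.sum_filter]
        refine Finset.sum_le_sum_of_subset_of_nonneg ?_ fun _ _ _ => hx
        intro k hk
        exact (Finset.mem_filter.1 hk).2
    _ = ⌊x⌋₊ * x := by simp
    _ ≤ x ^ 2 := by
        have := Nat.floor_le hx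
        nlinarith

section

variable [NeZero σ]

omit [NeZero σ] in
theorem branchBound_pow_le {m k : ℕ} (hm : 1 ≤ m) (x : ℝ) :
    branchBound σ (k / m) x ^ m ≤
      ENNReal.ofReal (Real.exp (-(laplaceRange σ / (2 * σ) * k))) +
        ENNReal.ofReal (if (k : ℝ) < m * (x - 1 / σ) then 1 else 0) := by
  have hm0 : (0 : ℝ) < m := by exact_mod_cast hm
  set c := laplaceRange σ / (2 * σ) with hc
  rw [branchBound]
  by_cases h1 : x - 1 / σ ≤ k / m
  · rw [if_pos h1]
    refine le_trans ?_ le_self_add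
    rcases le_total 0 (1 - c * (k / m)) with h | h
    · rw [← ENNReal.ofReal_pow h]
      refine ENNReal.ofReal_le_ofReal ?_
      have h3 : 1 - c * (k / m) ≤ Real.exp (-(c * (k / m))) := by
        have := Real.add_one_le_exp (-(c * (k / m)))
        linarith
      refine (pow_le_pow_left₀ h h3 m).trans (le_of_eq ?_)
      rw [← Real.exp_nat_mul]
      congr 1
      field_simp
    · rw [ENNReal.ofReal_of_nonpos h, zero_pow (by omega)]
      exact zero_le
  · have h2 : (k : ℝ) < m * (x - 1 / σ) := by
      rw [not_le, div_lt_iff₀ hm0] at h1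
      linarith
    rw [if_neg h1, if_pos h2, one_pow, ENNReal.ofReal_one]
    exact le_add_self

/-- The Laplace transform of the volume in terms of the threshold of the `m`-th backbone vertex. -/
theorem lintegral_iterate_peel_branchLaplace_le (hσ : 2 ≤ σ) {m k : ℕ} (hm : 1 ≤ m) (hk : 1 ≤ k)
    (hkm : (k : ℝ) / m ≤ laplaceRange σ) :
    ∫⁻ w, (peel 1)^[m] ((peel (branchLaplace ((k / m : ℝ) ^ 2) m))^[m] 1) w ∂treeMeasure σ ≤
      ∫⁻ w, (backward σ)^[m] 1 (threshold w) *
        (ENNReal.ofReal (Real.exp (-(laplaceRange σ / (2 * σ) * k))) +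
          ENNReal.ofReal (if (k : ℝ) < m * (threshold w - 1 / σ) then 1 else 0))
            ∂treeMeasure σ := by
  have hm0 : (0 : ℝ) < m := by exact_mod_cast hm
  have hk0 : (1 : ℝ) ≤ k := by exact_mod_cast hk
  have hρ : (0 : ℝ) < k / m := by positivity
  have hσ1 : (1 : ℝ) ≤ σ := by exact_mod_cast NeZero.one_le
  have hg := measurable_branchLaplace (σ := σ) ((k / m : ℝ) ^ 2) m
  have hΦ := measurable_iterate_peel hg measurable_one m
  have h1 := lintegral_iterate_peel_one (h := 1) measurable_one hΦ m
  simp only [Pi.one_apply, one_mul] at h1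
  rw [h1]
  have hε1 : laplaceRange σ ≤ 1 := by
    rw [laplaceRange, div_le_one (by positivity)]
    have : (1 : ℝ) ≤ (σ : ℝ) ^ 3 := one_le_pow₀ hσ1
    linarith
  -- Truncation at depth m leaves enough generations, because k ≥ 1 and ε ≤ 1.
  have hr : laplaceRange σ / (k / m) ≤ (m : ℝ) + 1 := by
    rw [div_le_iff₀ hρ]
    have : (m : ℝ) * (k / m) = k := by field_simp
    have h2 : 0 ≤ (k : ℝ) / m := hρ.le
    nlinarith
  refine (lintegral_iterate_peel_le hσ hg (branchBound_monotone hρ.le) (branchBound_le_one hρ.le)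
    (fun x hx hx1 => closedMean_branchLaplace_le hσ hρ hkm hr hx hx1) m
      (measurable_iterate_backward measurable_one m)).trans ?_
  exact lintegral_mono fun w => mul_le_mul_right (branchBound_pow_le hm _) _

end

theorem laplaceRange_pos [NeZero σ] : 0 < laplaceRange σ := by
  have hσ : (0 : ℝ) < σ := Nat.cast_pos.2 (NeZero.pos σ)
  rw [laplaceRange]
  positivity

theorem laplaceRange_le_one [NeZero σ] : laplaceRange σ ≤ 1 := by
  have hσ1 : (1 : ℝ) ≤ σ := by exact_mod_cast NeZero.one_le
  rw [laplaceRange, div_le_one (by positivity)]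
  have : (1 : ℝ) ≤ (σ : ℝ) ^ 3 := one_le_pow₀ hσ1
  linarith

/-- The weighted sum of the Laplace transforms of the volume is bounded uniformly in the scale. -/
theorem exists_sum_lintegral_le [NeZero σ] (hσ : 2 ≤ σ) :
    ∃ C : ℝ, ∀ m : ℕ, 1 ≤ m →
      ∑ k ∈ Finset.range (⌊laplaceRange σ * m⌋₊ + 1), ENNReal.ofReal k *
        ∫⁻ w, (peel 1)^[m] ((peel (branchLaplace ((k / m : ℝ) ^ 2) m))^[m] 1) w ∂treeMeasure σ ≤
          ENNReal.ofReal C := by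
  set ε := laplaceRange σ with hε
  have hε0 : 0 < ε := laplaceRange_pos
  have hσ0 : (0 : ℝ) < σ := Nat.cast_pos.2 (NeZero.pos σ)
  set c := ε / (2 * σ) with hc
  have hc0 : 0 < c := by positivity
  have hsum : Summable fun k : ℕ => (k : ℝ) * Real.exp (-(c * k)) := by
    have := Real.summable_pow_mul_exp_neg_nat_mul 1 hc0
    simpa using this
  set S := ∑' k : ℕ, (k : ℝ) * Real.exp (-(c * k)) with hS
  have hS0 : 0 ≤ S := tsum_nonneg fun k => by positivity
  refine ⟨S + 64 * (1 + σ ^ 3) ^ 2, fun m hm => ?_⟩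
  have hm0 : (0 : ℝ) < m := by exact_mod_cast hm
  set H : Weights σ → ℝ≥0∞ := fun w => (backward σ)^[m] 1 (threshold w) with hH
  have hHm : Measurable H :=
    (measurable_iterate_backward measurable_one m).comp measurable_threshold
  set T : ℕ → Weights σ → ℝ≥0∞ := fun k w => ENNReal.ofReal (Real.exp (-(c * k))) +
    ENNReal.ofReal (if (k : ℝ) < m * (threshold w - 1 / σ) then 1 else 0) with hT
  have hTm : ∀ k, Measurable (T k) := by
    intro k
    refine Measurable.const_add (ENNReal.measurable_ofReal.comp ?_) _
    exact Measurable.ite (measurableSet_lt measurable_const (by fun_prop)) measurable_const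
      measurable_const
  have hHT : ∀ k : ℕ, Measurable fun w => H w * (ENNReal.ofReal k * T k w) :=
    fun k => hHm.mul ((hTm k).const_mul _)
  have hterm : ∀ k ∈ Finset.range (⌊ε * m⌋₊ + 1), ENNReal.ofReal k *
      ∫⁻ w, (peel 1)^[m] ((peel (branchLaplace ((k / m : ℝ) ^ 2) m))^[m] 1) w ∂treeMeasure σ ≤
        ∫⁻ w, H w * (ENNReal.ofReal k * T k w) ∂treeMeasure σ := by
    intro k hk
    rcases Nat.eq_zero_or_pos k with rfl | hk1
    · simp
    have hkε : (k : ℝ) / m ≤ ε := by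
      rw [div_le_iff₀ hm0]
      exact le_trans (by exact_mod_cast Nat.lt_succ_iff.1 (Finset.mem_range.1 hk))
        (Nat.floor_le (by positivity))
    refine (mul_le_mul_right (lintegral_iterate_peel_branchLaplace_le hσ hm hk1 hkε) _).trans ?_
    rw [← lintegral_const_mul' _ _ ENNReal.ofReal_ne_top]
    refine le_of_eq (lintegral_congr fun w => ?_)
    exact mul_left_comm _ _ _
  -- Summing over k before integrating turns the tail probabilities into the second moment: the sum
  -- of all k < x is at most x².
  have hpoint : ∀ w : Weights σ,
      ∑ k ∈ Finset.range (⌊ε * m⌋₊ + 1), ENNReal.ofReal k * T k w ≤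
        ENNReal.ofReal S + ENNReal.ofReal (m ^ 2) * excess σ (threshold w) ^ 2 := by
    intro w
    set x : ℝ := m * (threshold w - 1 / σ) with hx
    have h1 : ∀ k : ℕ, ENNReal.ofReal k * T k w = ENNReal.ofReal (k * Real.exp (-(c * k)) +
        if (k : ℝ) < max x 0 then (k : ℝ) else 0) := by
      intro k
      have hk0 : (0 : ℝ) ≤ k := Nat.cast_nonneg k
      have hi : (0 : ℝ) ≤ if (k : ℝ) < x then 1 else 0 := by split_ifs <;> norm_num
      simp only [hT]
      rw [← ENNReal.ofReal_add (Real.exp_pos _).le hi, ← ENNReal.ofReal_mul hk0, mul_add]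
      congr 2
      simp only [lt_max_iff, not_lt.2 hk0, or_false]
      split_ifs <;> simp
    have h2 : ENNReal.ofReal (m ^ 2) * excess σ (threshold w) ^ 2 =
        ENNReal.ofReal (max x 0 ^ 2) := by
      rcases le_total 0 (threshold w - 1 / σ) with hy | hy
      · have hmx : max x 0 = x := max_eq_left (mul_nonneg hm0.le hy)
        rw [excess, ← ENNReal.ofReal_pow hy, ← ENNReal.ofReal_mul (by positivity), hmx, hx, mul_pow]
      · have hmx : max x 0 = 0 := max_eq_right (mul_nonpos_of_nonneg_of_nonpos hm0.le hy)
        rw [excess, ENNReal.ofReal_of_nonpos hy, hmx]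
        simp
    have hi (k : ℕ) : (0 : ℝ) ≤ k * Real.exp (-(c * k)) + if (k : ℝ) < max x 0 then (k : ℝ) else 0 :=
      add_nonneg (by positivity) (by split_ifs <;> positivity)
    rw [Finset.sum_congr rfl fun k _ => h1 k, ← ENNReal.ofReal_sum_of_nonneg fun k _ => hi k,
      Finset.sum_add_distrib, h2, ← ENNReal.ofReal_add hS0 (sq_nonneg _)]
    exact ENNReal.ofReal_le_ofReal (add_le_add (hsum.sum_le_tsum _ fun k _ => by positivity)
      (sum_ite_lt_le_sq (le_max_right _ _) _))
  calc _ ≤ ∑ k ∈ Finset.range (⌊ε * m⌋₊ + 1),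
        ∫⁻ w, H w * (ENNReal.ofReal k * T k w) ∂treeMeasure σ := Finset.sum_le_sum hterm
    _ = ∫⁻ w, H w * ∑ k ∈ Finset.range (⌊ε * m⌋₊ + 1), ENNReal.ofReal k * T k w
          ∂treeMeasure σ := by
        rw [← lintegral_finsetSum _ fun k _ => hHT k]
        refine lintegral_congr fun w => ?_
        rw [Finset.mul_sum]
    _ ≤ ∫⁻ w, (ENNReal.ofReal S * H w + ENNReal.ofReal (m ^ 2) *
          (H w * excess σ (threshold w) ^ 2)) ∂treeMeasure σ := by
        refine lintegral_mono fun w => (mul_le_mul_right (hpoint w) _).trans (le_of_eq ?_)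
        ring
    _ = ENNReal.ofReal S * ∫⁻ w, H w ∂treeMeasure σ + ENNReal.ofReal (m ^ 2) *
          ∫⁻ w, H w * excess σ (threshold w) ^ 2 ∂treeMeasure σ := by
        rw [lintegral_add_left (hHm.const_mul _), lintegral_const_mul' _ _ ENNReal.ofReal_ne_top,
          lintegral_const_mul' _ _ ENNReal.ofReal_ne_top]
    _ ≤ ENNReal.ofReal S * 1 + ENNReal.ofReal (m ^ 2) *
          ENNReal.ofReal (64 * (1 + σ ^ 3) ^ 2 / (m + 1) ^ 2) :=
        add_le_add (mul_le_mul_right (lintegral_iterate_backward_le_one m) _)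
          (mul_le_mul_right (lintegral_iterate_backward_excess_le hσ m) _)
    _ ≤ ENNReal.ofReal (S + 64 * (1 + σ ^ 3) ^ 2) := by
        rw [mul_one, ← ENNReal.ofReal_mul (by positivity), ← ENNReal.ofReal_add hS0 (by positivity)]
        refine ENNReal.ofReal_le_ofReal (add_le_add_right ?_ _)
        rw [mul_div_assoc', div_le_iff₀ (by positivity), mul_comm]
        refine mul_le_mul_of_nonneg_left ?_ (by positivity)
        nlinarith

theorem exists_lintegral_sq_div_le [NeZero σ] (hσ : 2 ≤ σ) :
    ∃ C : ℝ, ∀ m : ℕ, 1 ≤ m →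
      ∫⁻ w, ENNReal.ofReal ((m : ℝ) ^ 2 /
        clusterVolume (fun e => (w e : ℝ)) (m + m + m)) ∂treeMeasure σ ≤ ENNReal.ofReal C := by
  obtain ⟨C, hC⟩ := exists_sum_lintegral_le hσ
  set ε := laplaceRange σ with hε
  have hε0 : 0 < ε := laplaceRange_pos
  refine ⟨1 / ε ^ 2 + 4 * Real.exp 1 / ε ^ 2 * max C 0, fun m hm => ?_⟩
  set Φ : ℕ → Weights σ → ℝ≥0∞ := fun k =>
    (peel 1)^[m] ((peel (branchLaplace ((k / m : ℝ) ^ 2) m))^[m] 1) with hΦ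
  have hΦm : ∀ k, Measurable (Φ k) := fun k => measurable_iterate_peel measurable_one
    (measurable_iterate_peel (measurable_branchLaplace _ _) measurable_one m) m
  have hA : (0 : ℝ) ≤ 4 * Real.exp 1 / ε ^ 2 := by positivity
  calc ∫⁻ w, ENNReal.ofReal ((m : ℝ) ^ 2 /
        clusterVolume (fun e => (w e : ℝ)) (m + m + m)) ∂treeMeasure σ
      ≤ ∫⁻ w, (ENNReal.ofReal (1 / ε ^ 2) + ENNReal.ofReal (4 * Real.exp 1 / ε ^ 2) *
          ∑ k ∈ Finset.range (⌊ε * m⌋₊ + 1), ENNReal.ofReal k * Φ k w) ∂treeMeasure σ := by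
        refine lintegral_mono_ae ?_
        filter_upwards [ae_regular hσ] with w hw
        have hV : (1 : ℝ) ≤ clusterVolume (fun e => (w e : ℝ)) (m + m + m) := by
          exact_mod_cast one_le_clusterVolume _ _
        refine (ENNReal.ofReal_le_ofReal (sq_div_le_sum_exp hε0 laplaceRange_le_one hm hV)).trans ?_
        rw [ENNReal.ofReal_add (by positivity)
          (mul_nonneg hA (Finset.sum_nonneg fun k _ => by positivity)), ENNReal.ofReal_mul hA,
          ENNReal.ofReal_sum_of_nonneg fun k _ => by positivity]
        refine add_le_add_right (mul_le_mul_right (Finset.sum_le_sum fun k _ => ?_) _) _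
        rw [ENNReal.ofReal_mul (Nat.cast_nonneg k)]
        exact mul_le_mul_right (hw.exp_clusterVolume_le (sq_nonneg _) m m m) _
    _ = ENNReal.ofReal (1 / ε ^ 2) + ENNReal.ofReal (4 * Real.exp 1 / ε ^ 2) *
          ∑ k ∈ Finset.range (⌊ε * m⌋₊ + 1), ENNReal.ofReal k * ∫⁻ w, Φ k w ∂treeMeasure σ := by
        rw [lintegral_add_left measurable_const, lintegral_const, measure_univ, mul_one,
          lintegral_const_mul' _ _ ENNReal.ofReal_ne_top,
          lintegral_finsetSum _ fun k _ => (hΦm k).const_mul _]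
        congr 3
        funext k
        rw [lintegral_const_mul' _ _ ENNReal.ofReal_ne_top]
    _ ≤ ENNReal.ofReal (1 / ε ^ 2) + ENNReal.ofReal (4 * Real.exp 1 / ε ^ 2) *
          ENNReal.ofReal (max C 0) := by
        gcongr
        exact (hC m hm).trans (ENNReal.ofReal_le_ofReal (le_max_left _ _))
    _ = _ := by
        rw [← ENNReal.ofReal_mul hA, ← ENNReal.ofReal_add (by positivity)
          (mul_nonneg hA (le_max_right _ _))]

theorem exists_lintegral_clusterVolume_le [NeZero σ] (hσ : 2 ≤ σ) :
    ∃ C : ℝ, ∀ n : ℕ, ∫⁻ w, ENNReal.ofReal ((n : ℝ) ^ 2 /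
      clusterVolume (fun e => (w e : ℝ)) n) ∂treeMeasure σ ≤ ENNReal.ofReal C := by
  obtain ⟨C, hC⟩ := exists_lintegral_sq_div_le hσ
  refine ⟨max 4 (25 * C), fun n => ?_⟩
  have hV : ∀ (w : Weights σ) k, (1 : ℝ) ≤ clusterVolume (fun e => (w e : ℝ)) k := fun w k => by
    exact_mod_cast one_le_clusterVolume _ _
  rcases Nat.lt_or_ge n 3 with hn | hn
  · calc _ ≤ ∫⁻ _, ENNReal.ofReal (max 4 (25 * C)) ∂treeMeasure σ := by
          refine lintegral_mono fun w => ENNReal.ofReal_le_ofReal ?_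
          refine (div_le_self (sq_nonneg _) (hV w n)).trans (le_trans ?_ (le_max_left _ _))
          have : (n : ℝ) ≤ 2 := by exact_mod_cast Nat.lt_succ_iff.1 hn
          have : (0 : ℝ) ≤ n := Nat.cast_nonneg n
          nlinarith
      _ = _ := by simp
  -- For n ≥ 3 one has 3m ≤ n ≤ 3m + 2 ≤ 5m, whence the factor 25.
  · set m := n / 3 with hm
    have hm1 : 1 ≤ m := by omega
    calc _ ≤ ∫⁻ w, ENNReal.ofReal 25 * ENNReal.ofReal ((m : ℝ) ^ 2 /
          clusterVolume (fun e => (w e : ℝ)) (m + m + m)) ∂treeMeasure σ := by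
          refine lintegral_mono fun w => ?_
          rw [← ENNReal.ofReal_mul (by norm_num)]
          refine ENNReal.ofReal_le_ofReal ?_
          have h1 : (clusterVolume (fun e => (w e : ℝ)) (m + m + m) : ℝ) ≤
              clusterVolume (fun e => (w e : ℝ)) n := by
            exact_mod_cast clusterVolume_mono _ (by omega)
          have h2 : (n : ℝ) ≤ 5 * m := by exact_mod_cast (by omega : n ≤ 5 * m)
          have h3 : (n : ℝ) ^ 2 ≤ 25 * m ^ 2 := by
            have : (0 : ℝ) ≤ n := Nat.cast_nonneg n
            nlinarith
          rw [← mul_div_assoc]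
          exact div_le_div₀ (by positivity) h3 (by linarith [hV w (m + m + m)]) h1
      _ = ENNReal.ofReal 25 * ∫⁻ w, ENNReal.ofReal ((m : ℝ) ^ 2 /
          clusterVolume (fun e => (w e : ℝ)) (m + m + m)) ∂treeMeasure σ :=
          lintegral_const_mul' _ _ ENNReal.ofReal_ne_top
      _ ≤ ENNReal.ofReal 25 * ENNReal.ofReal C := mul_le_mul_right (hC m hm1) _
      _ = ENNReal.ofReal (25 * C) := (ENNReal.ofReal_mul (by norm_num)).symm
      _ ≤ _ := ENNReal.ofReal_le_ofReal (le_max_right _ _)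

/-! ### Transfer to arbitrary independent uniform weights -/

theorem map_projIcc_restrict_Ioo :
    (volume.restrict (Set.Ioo (0 : ℝ) 1)).map (Set.projIcc (0 : ℝ) 1 zero_le_one) =
      (volume : Measure unitInterval) := by
  rw [Measure.restrict_congr_set Ioo_ae_eq_Icc, ← unitInterval.measurePreserving_coe.map_eq,
    Measure.map_map continuous_projIcc.measurable measurable_subtype_coe]
  have : Set.projIcc (0 : ℝ) 1 zero_le_one ∘ ((↑) : unitInterval → ℝ) = id :=
    funext fun x => Set.projIcc_val _ x
  rw [this, Measure.map_id]

theorem measurable_sq_div_clusterVolume (n : ℕ) : Measurable fun w : Weights σ =>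
    (n : ℝ) ^ 2 / (clusterVolume (fun e => (w e : ℝ)) n : ℝ) := by
  have h1 : Measurable fun w : Weights σ => (clusterVolume (fun e => (w e : ℝ)) n : ℝ) :=
    measurable_from_nat.comp ((measurable_clusterVolume n).comp
      (measurable_pi_lambda _ fun e => measurable_subtype_coe.comp (measurable_pi_apply e)))
  exact measurable_const.div h1

theorem integrable_and_bddAbove_sq_div_clusterVolume (hσ : 2 ≤ σ)
    {Ω : Type*} [MeasurableSpace Ω] (μ : Measure Ω) [IsProbabilityMeasure μ]
    (U : Edge σ → Ω → ℝ)
    (hlaw : ∀ e, HasLaw (U e) (volume.restrict (Set.Ioo (0 : ℝ) 1)) μ)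
    (hindep : iIndepFun U μ) :
    (∀ n : ℕ, Integrable
      (fun ω => (n : ℝ) ^ 2 / (clusterVolume (fun e => U e ω) n : ℝ)) μ) ∧
    BddAbove (Set.range fun n : ℕ =>
      ∫ ω, (n : ℝ) ^ 2 / (clusterVolume (fun e => U e ω) n : ℝ) ∂μ) := by
  have : NeZero σ := ⟨by omega⟩
  set proj := Set.projIcc (0 : ℝ) 1 zero_le_one with hproj
  have hprojm : Measurable proj := continuous_projIcc.measurable
  have hV : ∀ e, HasLaw (fun ω => proj (U e ω)) (volume : Measure unitInterval) μ := fun e =>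
    HasLaw.comp ⟨hprojm.aemeasurable, map_projIcc_restrict_Ioo⟩ (hlaw e)
  -- Clamping to [0,1] changes the weights only on a null set, and by independence the clamped
  -- family has the product law.
  have hW : HasLaw (fun ω e => proj (U e ω)) (treeMeasure σ) μ :=
    (hindep.comp (fun _ => proj) fun _ => hprojm).hasLaw_infinitePi hV
      (aemeasurable_pi_iff.2 fun e => (hV e).aemeasurable)
  have hmem : ∀ᵐ ω ∂μ, ∀ e, U e ω ∈ Set.Icc (0 : ℝ) 1 := by
    refine ae_all_iff.2 fun e => ?_
    have h1 : ∀ᵐ x ∂volume.restrict (Set.Ioo (0 : ℝ) 1), x ∈ Set.Icc (0 : ℝ) 1 := by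
      filter_upwards [ae_restrict_mem measurableSet_Ioo] with x hx
      exact Set.Ioo_subset_Icc_self hx
    rw [← (hlaw e).map_eq] at h1
    exact ae_of_ae_map (hlaw e).aemeasurable h1
  set f : ℕ → Weights σ → ℝ := fun n w =>
    (n : ℝ) ^ 2 / (clusterVolume (fun e => (w e : ℝ)) n : ℝ) with hf
  have hfm : ∀ n, Measurable (f n) := measurable_sq_div_clusterVolume
  have hf0 : ∀ n w, 0 ≤ f n w := fun n w => by positivity
  have heq : ∀ n : ℕ, (fun ω => (n : ℝ) ^ 2 / (clusterVolume (fun e => U e ω) n : ℝ)) =ᵐ[μ]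
      fun ω => f n fun e => proj (U e ω) := by
    intro n
    filter_upwards [hmem] with ω hω
    have : (fun e => ((proj (U e ω) : unitInterval) : ℝ)) = fun e => U e ω := by
      funext e
      rw [hproj, Set.projIcc_of_mem _ (hω e)]
    simp only [hf, this]
  obtain ⟨C, hC⟩ := exists_lintegral_clusterVolume_le hσ
  have hint : ∀ n, Integrable (f n) (treeMeasure σ) := by
    intro n
    refine ⟨(hfm n).aestronglyMeasurable, ?_⟩
    rw [hasFiniteIntegral_iff_ofReal (Filter.Eventually.of_forall (hf0 n))]
    exact (hC n).trans_lt ENNReal.ofReal_lt_top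
  refine ⟨fun n => ?_, max C 0, ?_⟩
  · refine Integrable.congr ?_ (heq n).symm
    have h := hint n
    rw [← hW.map_eq] at h
    exact h.comp_aemeasurable hW.aemeasurable
  · rintro _ ⟨n, rfl⟩
    simp only
    rw [integral_congr_ae (heq n)]
    have h := hW.integral_comp (f := f n) (hfm n).aestronglyMeasurable
    refine (le_of_eq h).trans ?_
    rw [integral_eq_lintegral_of_nonneg_ae (Filter.Eventually.of_forall (hf0 n))
      (hfm n).aestronglyMeasurable]
    refine ENNReal.toReal_le_of_le_ofReal (le_max_right _ _) ((hC n).trans ?_)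
    exact ENNReal.ofReal_le_ofReal (le_max_left _ _)

end InvasionTree

theorem theorem1p9 (σ : ℕ) (hσ : 2 ≤ σ)
    {Ω : Type*} [MeasurableSpace Ω] (μ : Measure Ω) [IsProbabilityMeasure μ]
    (U : InvasionTree.Edge σ → Ω → ℝ)
    (hlaw : ∀ e, HasLaw (U e) (volume.restrict (Set.Ioo (0 : ℝ) 1)) μ)
    (hindep : iIndepFun U μ) :
    (∀ n : ℕ, Integrable
      (fun ω => (n : ℝ) ^ 2 / (InvasionTree.clusterVolume (fun e => U e ω) n : ℝ)) μ) ∧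
    BddAbove (Set.range fun n : ℕ =>
      ∫ ω, (n : ℝ) ^ 2 / (InvasionTree.clusterVolume (fun e => U e ω) n : ℝ) ∂μ) :=
  InvasionTree.integrable_and_bddAbove_sq_div_clusterVolume hσ μ U hlaw hindep
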